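/- Let $k$ be a field of characteristic $p>0$ and let $k[\boldsymbol x]=k[x_1,x_2,x_3]$ be the polynomial ring in three variables. Fix integers $l,m\ge 1$ and $t\ge 2$ with $mt\ge 3$, and set $$f:=x_1x_3-x_2^t,\qquad r:=f^lx_2+x_1^m,\qquad g:=x_1^{-1}\bigl(f^{lt+1}+r^t\bigr)\in k[\boldsymbol x],\qquad C:=k[f,f^{-1},g,g^{-1}]\subset k(x_1,x_2,x_3).$$ The element $r$ is transcendental over $C$, one has $k[\boldsymbol x]\subset C[r]$, and the map $C[r]\to C[r][T]$, $u(r)\mapsto u(r+f^lg\,T)$ (for polynomials $u$ over $C$) restricts to a ${\bf G}_a$-action $\epsilon:k[\boldsymbol x]\to k[\boldsymbol x][T]$. Let $k[\boldsymbol x]^{\epsilon}=\{u\mid \epsilon(u)=u\}$, let $0\neq h\in k[\boldsymbol x]^{\epsilon}$, let $\epsilon_h:k[\boldsymbol x]\to k[\boldsymbol x]$ be the map $u\mapsto \epsilon(u)|_{T=h}$, and let $k[\boldsymbol x]^{\epsilon_h}=\{u\mid \epsilon_h(u)=u\}$. Put $$q:=r^p-(f^lgh)^{p-1}r,\qquad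 \psi:C[r^p]\to C[q],\quad u(r^p)\mapsto u(q)\ \text{ (for polynomials $u$ over $C$)}.$$ Assume that $p\mid t$, and put $q_1:=g^{-1}\bigl(f^{lt+1}+q^{t/p}\bigr)$. (i) The element $q_1$ lies in $k[\boldsymbol x]^{\epsilon_h}$, and there exist $q_2,q_3\in k[\boldsymbol x]^{\epsilon_h}$ such that $q_1q_3-q_2^{t/p}=f$ and $k[\boldsymbol x]^{\epsilon_h}=k[q_1,q_2,q_3]$. Here $q_1,q_2,q_3$ are algebraically independent over $k$; in particular, $k[\boldsymbol x]^{\epsilon_h}$ is isomorphic as a $k$-algebra to the polynomial ring in three variables over $k$. (ii) One has $k[x_1,x_2^p,x_3]\subset C[r^p]$, and $$\psi\bigl(k[x_1,x_2^p,x_3]\bigr)=k[\boldsymbol x]^{\epsilon_h}\quad\Longleftrightarrow\quad h^{p-1}\in f^l\,k[f,g].$$ -/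

import Mathlib

/-- The fixed exponents: `l, m ≥ 1`, `t ≥ 2` and `m t ≥ 3`. -/
structure Exponents where
  l : ℕ
  m : ℕ
  t : ℕ
  one_le_l : 1 ≤ l
  one_le_m : 1 ≤ m
  two_le_t : 2 ≤ t
  three_le_mt : 3 ≤ m * t

namespace RankThree

noncomputable section

/-- The polynomial ring `k[x₁, x₂, x₃]`; the variables `x₁, x₂, x₃` are `X 0, X 1, X 2`. -/
abbrev Poly (k : Type*) [Field k] : Type _ := MvPolynomial (Fin 3) k

/-- The field of rational functions `k(x₁, x₂, x₃)`. -/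
abbrev RatFun (k : Type*) [Field k] : Type _ := FractionRing (Poly k)

/-- The inclusion of `k[x₁, x₂, x₃]` into `k(x₁, x₂, x₃)`. -/
abbrev incl (k : Type*) [Field k] : Poly k →ₐ[k] RatFun k := IsScalarTower.toAlgHom k (Poly k) (RatFun k)

/-- `f = x₁ x₃ - x₂ ^ t`. -/
def f (k : Type*) [Field k] (E : Exponents) : Poly k :=
  MvPolynomial.X 0 * MvPolynomial.X 2 - MvPolynomial.X 1 ^ E.t

/-- `r = f ^ l x₂ + x₁ ^ m`. -/
def r (k : Type*) [Field k] (E : Exponents) : Poly k :=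
  f k E ^ E.l * MvPolynomial.X 1 + MvPolynomial.X 0 ^ E.m

/-- The polynomial `g = x₁⁻¹ (f ^ (l t + 1) + r ^ t)`, written out by means of the binomial
expansion of `r ^ t`; see `X_zero_mul_g`. -/
def g (k : Type*) [Field k] (E : Exponents) : Poly k :=
  f k E ^ (E.l * E.t) * MvPolynomial.X 2 +
    ∑ i ∈ Finset.range E.t, (f k E ^ E.l * MvPolynomial.X 1) ^ i *
      MvPolynomial.X 0 ^ (E.m * (E.t - i) - 1) * (E.t.choose i : Poly k)

theorem f_eq (k : Type*) [Field k] (E : Exponents) :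
    f k E = MvPolynomial.X 0 * MvPolynomial.X 2 - MvPolynomial.X 1 ^ E.t := rfl

theorem r_eq (k : Type*) [Field k] (E : Exponents) :
    r k E = f k E ^ E.l * MvPolynomial.X 1 + MvPolynomial.X 0 ^ E.m := rfl

theorem g_eq (k : Type*) [Field k] (E : Exponents) :
    g k E = f k E ^ (E.l * E.t) * MvPolynomial.X 2 +
      ∑ i ∈ Finset.range E.t, (f k E ^ E.l * MvPolynomial.X 1) ^ i *
        MvPolynomial.X 0 ^ (E.m * (E.t - i) - 1) * (E.t.choose i : Poly k) := rfl

theorem X_zero_mul_g (k : Type*) [Field k] (E : Exponents) :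
    MvPolynomial.X 0 * g k E = f k E ^ (E.l * E.t + 1) + r k E ^ E.t := by
  have key : ∀ i ∈ Finset.range E.t, MvPolynomial.X 0 * ((f k E ^ E.l * MvPolynomial.X 1) ^ i *
      MvPolynomial.X 0 ^ (E.m * (E.t - i) - 1) * (E.t.choose i : Poly k)) =
      (f k E ^ E.l * MvPolynomial.X 1) ^ i *
        (MvPolynomial.X 0 ^ E.m) ^ (E.t - i) * (E.t.choose i : Poly k) := by
    intro i hi
    have h1 : 1 ≤ E.m * (E.t - i) :=
      Nat.mul_pos E.one_le_m (Nat.sub_pos_of_lt (Finset.mem_range.mp hi))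
    obtain ⟨n, hn⟩ := Nat.exists_eq_add_of_le h1
    rw [← pow_mul, hn, Nat.add_sub_cancel_left]
    ring
  have hr : r k E ^ E.t = ∑ i ∈ Finset.range E.t, (f k E ^ E.l * MvPolynomial.X 1) ^ i *
        (MvPolynomial.X 0 ^ E.m) ^ (E.t - i) * (E.t.choose i : Poly k) +
        (f k E ^ E.l * MvPolynomial.X 1) ^ E.t := by
    rw [r, add_pow, Finset.sum_range_succ]
    simp
  have hf : f k E ^ (E.l * E.t + 1) = f k E ^ (E.l * E.t) *
      (MvPolynomial.X 0 * MvPolynomial.X 2 - MvPolynomial.X 1 ^ E.t) := by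
    rw [pow_succ]; rfl
  rw [g, mul_add, Finset.mul_sum, Finset.sum_congr rfl key, hr, hf, mul_pow _ _ E.t, ← pow_mul]
  ring

theorem f_ne_zero (k : Type*) [Field k] (E : Exponents) : f k E ≠ 0 := by
  intro h
  have := congrArg (MvPolynomial.eval (![1, 0, 1] : Fin 3 → k)) h
  have ht : E.t ≠ 0 := by have := E.two_le_t; omega
  simp [f, ht] at this

theorem g_ne_zero (k : Type*) [Field k] (E : Exponents) : g k E ≠ 0 := by
  intro h
  have h2 := X_zero_mul_g k E
  have h1 := congrArg (MvPolynomial.eval (![1, 0, 0] : Fin 3 → k)) h2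
  have ht : E.t ≠ 0 := by have := E.two_le_t; omega
  rw [h] at h1
  simp [f, r, ht] at h1

/-- The ring `C = k[f, f⁻¹, g, g⁻¹]`, inside `k(x₁, x₂, x₃)`. -/
def ringC (k : Type*) [Field k] (E : Exponents) : Subalgebra k (RatFun k) :=
  Algebra.adjoin k
    {incl k (f k E), (incl k (f k E))⁻¹, incl k (g k E), (incl k (g k E))⁻¹}

theorem f_mem (k : Type*) [Field k] (E : Exponents) : incl k (f k E) ∈ ringC k E :=
  Algebra.subset_adjoin (by simp)

theorem f_inv_mem (k : Type*) [Field k] (E : Exponents) : (incl k (f k E))⁻¹ ∈ ringC k E :=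
  Algebra.subset_adjoin (by simp)

theorem g_mem (k : Type*) [Field k] (E : Exponents) : incl k (g k E) ∈ ringC k E :=
  Algebra.subset_adjoin (by simp)

theorem g_inv_mem (k : Type*) [Field k] (E : Exponents) : (incl k (g k E))⁻¹ ∈ ringC k E :=
  Algebra.subset_adjoin (by simp)

theorem X_zero_eq (k : Type*) [Field k] (E : Exponents) :
    incl k (MvPolynomial.X 0) = (incl k (g k E))⁻¹ *
      (incl k (f k E) ^ (E.l * E.t + 1) + incl k (r k E) ^ E.t) := by
  have hg : incl k (g k E) ≠ 0 := by simpa using g_ne_zero k E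
  have := congrArg (incl k) (X_zero_mul_g k E)
  rw [map_mul, map_add, map_pow, map_pow] at this
  rw [← this]
  field_simp

theorem X_one_eq (k : Type*) [Field k] (E : Exponents) :
    incl k (MvPolynomial.X 1) = (incl k (f k E))⁻¹ ^ E.l *
      (incl k (r k E) - incl k (MvPolynomial.X 0) ^ E.m) := by
  have hf : incl k (f k E) ≠ 0 := by simpa using f_ne_zero k E
  have : incl k (r k E) = incl k (f k E) ^ E.l * incl k (MvPolynomial.X 1) +
      incl k (MvPolynomial.X 0) ^ E.m := by
    rw [← map_pow, ← map_pow, ← map_mul, ← map_add]; rfl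
  rw [this, add_sub_cancel_right, ← mul_assoc, ← mul_pow, inv_mul_cancel₀ hf, one_pow, one_mul]

theorem X_two_eq (k : Type*) [Field k] (E : Exponents) :
    incl k (MvPolynomial.X 2) = (incl k (f k E))⁻¹ ^ (E.l * E.t) *
      (incl k (g k E) - ∑ i ∈ Finset.range E.t,
        (incl k (f k E) ^ E.l * incl k (MvPolynomial.X 1)) ^ i *
        incl k (MvPolynomial.X 0) ^ (E.m * (E.t - i) - 1) * (E.t.choose i : RatFun k)) := by
  have hf : incl k (f k E) ≠ 0 := by simpa using f_ne_zero k E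
  have : incl k (g k E) = incl k (f k E) ^ (E.l * E.t) * incl k (MvPolynomial.X 2) +
      ∑ i ∈ Finset.range E.t,
        (incl k (f k E) ^ E.l * incl k (MvPolynomial.X 1)) ^ i *
        incl k (MvPolynomial.X 0) ^ (E.m * (E.t - i) - 1) * (E.t.choose i : RatFun k) := by
    conv_lhs => rw [g]
    simp only [map_add, map_mul, map_sum, map_pow, map_natCast]
  rw [this, add_sub_cancel_right, ← mul_assoc, ← mul_pow, inv_mul_cancel₀ hf, one_pow, one_mul]

/-- A `k`-subalgebra of `k(x₁, x₂, x₃)` containing `C` and `r` contains `k[x₁, x₂, x₃]`. -/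
theorem incl_mem_of_le {k : Type*} [Field k] (E : Exponents) (S : Subalgebra k (RatFun k))
    (hC : ringC k E ≤ S) (hr : incl k (r k E) ∈ S) (u : Poly k) : incl k u ∈ S := by
  have h0 : incl k (MvPolynomial.X 0) ∈ S := by
    rw [X_zero_eq k E]
    exact S.mul_mem (hC (g_inv_mem k E))
      (S.add_mem (S.pow_mem (hC (f_mem k E)) _) (S.pow_mem hr _))
  have h1 : incl k (MvPolynomial.X 1) ∈ S := by
    rw [X_one_eq k E]
    exact S.mul_mem (S.pow_mem (hC (f_inv_mem k E)) _) (S.sub_mem hr (S.pow_mem h0 _))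
  have h2 : incl k (MvPolynomial.X 2) ∈ S := by
    rw [X_two_eq k E]
    refine S.mul_mem (S.pow_mem (hC (f_inv_mem k E)) _) (S.sub_mem (hC (g_mem k E))
      (S.sum_mem fun i _ => S.mul_mem (S.mul_mem (S.pow_mem (S.mul_mem
        (S.pow_mem (hC (f_mem k E)) _) h1) _) (S.pow_mem h0 _)) (natCast_mem S _)))
  induction u using MvPolynomial.induction_on with
  | C a =>
    have : incl k (MvPolynomial.C a) = algebraMap k (RatFun k) a := (incl k).commutes a
    rw [this]; exact S.algebraMap_mem a
  | add p q hp hq => rw [map_add]; exact S.add_mem hp hq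
  | mul_X p i hp =>
    rw [map_mul]
    refine S.mul_mem hp ?_
    fin_cases i
    · exact h0
    · exact h1
    · exact h2

/-- `r` is transcendental over `C`. -/
theorem transcendental_r (k : Type*) [Field k] (E : Exponents) :
    Transcendental (ringC k E) (incl k (r k E)) := by
  intro halg
  let s : Set (RatFun k) := {incl k (f k E), incl k (g k E)}
  let F := IntermediateField.adjoin k s
  have hfF : incl k (f k E) ∈ F := IntermediateField.subset_adjoin k s (by simp [s])
  have hgF : incl k (g k E) ∈ F := IntermediateField.subset_adjoin k s (by simp [s])
  have hCF : ringC k E ≤ F.toSubalgebra := by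
    refine Algebra.adjoin_le ?_
    rintro x (rfl | rfl | rfl | rfl)
    · exact hfF
    · exact F.inv_mem hfF
    · exact hgF
    · exact F.inv_mem hgF
  have halgF : IsAlgebraic F (incl k (r k E)) := by
    obtain ⟨u, hu, hu0⟩ := halg
    let j : ringC k E →+* F := (Subalgebra.inclusion hCF).toRingHom
    have hj : Function.Injective j := Subalgebra.inclusion_injective hCF
    refine ⟨u.map j, (Polynomial.map_ne_zero_iff hj).mpr hu, ?_⟩
    rw [Polynomial.aeval_def, Polynomial.eval₂_map]
    exact hu0
  let L := algebraicClosure F (RatFun k)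
  have hCL : ringC k E ≤ L.toSubalgebra.restrictScalars k := fun x hx =>
    L.algebraMap_mem (⟨x, hCF hx⟩ : F)
  have hP : ∀ u : Poly k, incl k u ∈ L :=
    incl_mem_of_le E (L.toSubalgebra.restrictScalars k) hCL (mem_algebraicClosure_iff.mpr halgF)
  have hall : Algebra.IsAlgebraic F (RatFun k) := by
    refine ⟨fun x => ?_⟩
    obtain ⟨a, b, -, rfl⟩ := IsFractionRing.div_surjective (A := Poly k) x
    exact mem_algebraicClosure_iff.mp (L.div_mem (hP a) (hP b))
  have hall' : Algebra.IsAlgebraic (Algebra.adjoin k s) (RatFun k) :=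
    IntermediateField.isAlgebraic_adjoin_iff_top.mp hall
  have hle := Algebra.IsAlgebraic.trdeg_le_cardinalMk k s
  have hX : AlgebraicIndependent k (fun i : Fin 3 => incl k (MvPolynomial.X i)) :=
    (MvPolynomial.algebraicIndependent_X (Fin 3) k).map'
      (IsFractionRing.injective (Poly k) (RatFun k))
  have h3 := hX.lift_cardinalMk_le_trdeg
  have hs : Cardinal.mk s ≤ 2 := by
    refine (Cardinal.mk_insert_le).trans ?_
    simp [one_add_one_eq_two]
  have h4 := h3.trans (Cardinal.lift_le.mpr (hle.trans hs))
  simp only [Cardinal.mk_fin, Cardinal.lift_natCast, Cardinal.lift_ofNat] at h4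
  exact absurd h4 (by norm_cast)

/-- The ring `C[r]`. -/
def ringCr (k : Type*) [Field k] (E : Exponents) : Subalgebra (ringC k E) (RatFun k) :=
  (Polynomial.aeval (R := ringC k E) (incl k (r k E))).range

/-- `C[r]` is the polynomial ring in `r` over `C`. -/
def polyEquivCr (k : Type*) [Field k] (E : Exponents) :
    Polynomial (ringC k E) ≃ₐ[ringC k E] ringCr k E :=
  AlgEquiv.ofInjective (Polynomial.aeval (R := ringC k E) (incl k (r k E)))
    (transcendental_iff_injective.mp (transcendental_r k E))

theorem r_mem (k : Type*) [Field k] (E : Exponents) : incl k (r k E) ∈ ringCr k E :=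
  ⟨Polynomial.X, by simp⟩

theorem incl_mem_ringCr (k : Type*) [Field k] (E : Exponents) (u : Poly k) :
    incl k u ∈ ringCr k E :=
  incl_mem_of_le E ((ringCr k E).restrictScalars k)
    (fun x hx => (ringCr k E).algebraMap_mem (⟨x, hx⟩ : ringC k E)) (r_mem k E) u

/-- The inclusion of `k[x₁, x₂, x₃]` into `C[r]`. -/
def inclCr (k : Type*) [Field k] (E : Exponents) : Poly k →ₐ[k] ringCr k E :=
  (incl k).codRestrict ((ringCr k E).restrictScalars k) (incl_mem_ringCr k E)

/-- The action `C[r] → C[r][T]`, `u(r) ↦ u(r + f ^ l g T)`, for `u` a polynomial over `C`. -/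
def actionCr (k : Type*) [Field k] (E : Exponents) :
    ringCr k E →ₐ[ringC k E] Polynomial (ringCr k E) :=
  (Polynomial.aeval (Polynomial.C (inclCr k E (r k E)) +
    Polynomial.C (inclCr k E (f k E ^ E.l * g k E)) * Polynomial.X)).comp
      (polyEquivCr k E).symm.toAlgHom

/-- The restriction of `actionCr` to `k[x₁, x₂, x₃]`, with values in `k(x₁, x₂, x₃)[T]`. -/
def actionRat (k : Type*) [Field k] (E : Exponents) : Poly k →ₐ[k] Polynomial (RatFun k) :=
  (Polynomial.mapAlgHom ((ringCr k E).val.restrictScalars k)).comp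
    (((actionCr k E).restrictScalars k).comp (inclCr k E))

/-- The inclusion of `k[x₁, x₂, x₃][T]` into `k(x₁, x₂, x₃)[T]`. -/
def inclPoly (k : Type*) [Field k] : Polynomial (Poly k) →ₐ[k] Polynomial (RatFun k) :=
  Polynomial.mapAlgHom (incl k)

theorem inclPoly_injective (k : Type*) [Field k] : Function.Injective (inclPoly k) :=
  Polynomial.map_injective _ (IsFractionRing.injective (Poly k) (RatFun k))

theorem actionRat_apply (k : Type*) [Field k] (E : Exponents) (u : Poly k) :
    actionRat k E u = (actionCr k E (inclCr k E u)).map (ringCr k E).val.toRingHom := rfl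

theorem inclPoly_apply (k : Type*) [Field k] (u : Polynomial (Poly k)) :
    inclPoly k u = u.map (incl k).toRingHom := rfl

theorem actionRat_of_mem (k : Type*) [Field k] (E : Exponents) (u : Poly k)
    (hu : incl k u ∈ ringC k E) : actionRat k E u = inclPoly k (Polynomial.C u) := by
  have h1 : inclCr k E u = algebraMap (ringC k E) (ringCr k E) ⟨incl k u, hu⟩ := rfl
  have h3 : algebraMap (ringC k E) (Polynomial (ringCr k E)) ⟨incl k u, hu⟩ =
      Polynomial.C (algebraMap (ringC k E) (ringCr k E) ⟨incl k u, hu⟩) := rfl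
  rw [actionRat_apply, inclPoly_apply, h1, AlgHom.commutes, h3, Polynomial.map_C,
    Polynomial.map_C]
  rfl

theorem actionRat_r (k : Type*) [Field k] (E : Exponents) :
    actionRat k E (r k E) = inclPoly k (Polynomial.C (r k E) +
      Polynomial.C (f k E ^ E.l * g k E) * Polynomial.X) := by
  have h1 : (polyEquivCr k E).symm (inclCr k E (r k E)) = Polynomial.X := by
    rw [AlgEquiv.symm_apply_eq]
    apply Subtype.ext
    change _ = Polynomial.aeval (R := ringC k E) (incl k (r k E)) Polynomial.X
    rw [Polynomial.aeval_X]
    rfl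
  have h2 : actionCr k E (inclCr k E (r k E)) = Polynomial.aeval
      (Polynomial.C (inclCr k E (r k E)) +
        Polynomial.C (inclCr k E (f k E ^ E.l * g k E)) * Polynomial.X)
        ((polyEquivCr k E).symm (inclCr k E (r k E))) := rfl
  rw [actionRat_apply, inclPoly_apply, h2, h1, Polynomial.aeval_X]
  simp only [Polynomial.map_add, Polynomial.map_mul, Polynomial.map_C, Polynomial.map_X]
  rfl

theorem prime_f (k : Type*) [Field k] (E : Exponents) : Prime (f k E) := by
  have ht : E.t ≠ 0 := by have := E.two_le_t; omega
  have h := MvPolynomial.irreducible_mul_X_add (R := k) (MvPolynomial.X (0 : Fin 3))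
    (-MvPolynomial.X 1 ^ E.t) 2 (by simp) (by simp [MvPolynomial.vars_X]) (by
      intro h2
      rw [MvPolynomial.vars_neg] at h2
      have := MvPolynomial.vars_pow _ _ h2
      simp [MvPolynomial.vars_X] at this) (by
      refine (Irreducible.isRelPrime_iff_not_dvd (MvPolynomial.X_prime (R := k) (i := (0 : Fin 3))).irreducible).mpr ?_
      rintro ⟨c, hc⟩
      have := congrArg (MvPolynomial.eval (![0, 1, 0] : Fin 3 → k)) hc
      simp at this)
  have h' : Irreducible (f k E) := by
    rw [f, sub_eq_add_neg]; exact h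
  exact h'.prime

theorem not_dvd (k : Type*) [Field k] (E : Exponents) (D : Polynomial (Poly k)) :
    ¬ Polynomial.C (f k E) ∣
      Polynomial.C (MvPolynomial.X 0) + Polynomial.C (f k E ^ E.l) * D := by
  intro h
  have hl : E.l ≠ 0 := by have := E.one_le_l; omega
  have h1 : Polynomial.C (f k E) ∣ Polynomial.C (f k E ^ E.l) * D :=
    Dvd.dvd.mul_right (map_dvd Polynomial.C (dvd_pow_self _ hl)) D
  have h2 := (dvd_add_left h1).mp h
  obtain ⟨c, hc⟩ := (Polynomial.C_dvd_iff_dvd_coeff _ _).mp h2 0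
  have := congrArg (MvPolynomial.eval (![1, 1, 1] : Fin 3 → k)) hc
  simp [f] at this

theorem actionRat_mem (k : Type*) [Field k] (E : Exponents) (u : Poly k) :
    actionRat k E u ∈ (inclPoly k).range := by
  have hinj := inclPoly_injective k
  obtain ⟨R, hR⟩ : ∃ R, R = Polynomial.C (r k E) +
      Polynomial.C (f k E ^ E.l * g k E) * Polynomial.X := ⟨_, rfl⟩
  have hr : actionRat k E (r k E) = inclPoly k R := by rw [hR]; exact actionRat_r k E
  have hf := actionRat_of_mem k E _ (f_mem k E)
  have hg := actionRat_of_mem k E _ (g_mem k E)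
  have hCf : Polynomial.C (f k E) ≠ 0 := by simpa using f_ne_zero k E
  have hCg : Polynomial.C (g k E) ≠ 0 := by simpa using g_ne_zero k E
  have e0 := congrArg (actionRat k E) (X_zero_mul_g k E)
  have e1 := congrArg (actionRat k E) (r_eq k E)
  have e2 := congrArg (actionRat k E) (f_eq k E)
  have e3 := congrArg (actionRat k E) (g_eq k E)
  simp only [map_mul, map_add, map_sub, map_pow, map_sum, map_natCast, hf, hg, hr]
    at e0 e1 e2 e3
  -- the image of the first variable
  obtain ⟨W, hW⟩ := sub_dvd_pow_sub_pow R (Polynomial.C (r k E)) E.t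
  have h0 : actionRat k E (MvPolynomial.X 0) = inclPoly k (Polynomial.C (MvPolynomial.X 0) +
      Polynomial.C (f k E ^ E.l) * (Polynomial.X * W)) := by
    refine mul_right_cancel₀ ((map_ne_zero_iff _ hinj).mpr hCg) ?_
    rw [e0]
    simp only [← map_mul, ← map_add, ← map_pow]
    congr 1
    have hx := congrArg Polynomial.C (X_zero_mul_g k E)
    simp only [map_mul, map_add, map_pow] at hx hW hR ⊢
    rw [hR] at hW ⊢
    linear_combination hW - hx
  obtain ⟨X0, hX0⟩ : ∃ X0, X0 = Polynomial.C (MvPolynomial.X 0) +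
      Polynomial.C (f k E ^ E.l) * (Polynomial.X * W) := ⟨_, rfl⟩
  rw [← hX0] at h0
  -- the image of the second variable
  obtain ⟨V, hV⟩ := sub_dvd_pow_sub_pow X0 (Polynomial.C (MvPolynomial.X 0)) E.m
  obtain ⟨X1, hX1⟩ : ∃ X1, X1 = Polynomial.C (MvPolynomial.X 1) +
      Polynomial.C (g k E) * Polynomial.X - Polynomial.X * W * V := ⟨_, rfl⟩
  have h1 : actionRat k E (MvPolynomial.X 1) = inclPoly k X1 := by
    refine mul_left_cancel₀ (pow_ne_zero E.l ((map_ne_zero_iff _ hinj).mpr hCf)) ?_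
    rw [h0] at e1
    rw [← sub_eq_iff_eq_add] at e1
    rw [← e1]
    simp only [← map_mul, ← map_sub, ← map_pow]
    congr 1
    have hx := congrArg Polynomial.C (r_eq k E)
    have hX0' : X0 - Polynomial.C (MvPolynomial.X 0) =
      Polynomial.C (f k E ^ E.l) * (Polynomial.X * W) := by rw [hX0]; ring
    rw [hX0'] at hV
    simp only [map_mul, map_add, map_pow] at hx hV hR ⊢
    rw [hR, hX1]
    linear_combination hx - hV
  -- the image of the third variable
  have h2 : actionRat k E (MvPolynomial.X 2) ∈ (inclPoly k).range := by
    rw [h0, h1] at e2 e3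
    obtain ⟨N, hN⟩ : ∃ N, N = Polynomial.C (g k E) -
      ∑ i ∈ Finset.range E.t, (Polynomial.C (f k E) ^ E.l * X1) ^ i *
        X0 ^ (E.m * (E.t - i) - 1) * (E.t.choose i : Polynomial (Poly k)) := ⟨_, rfl⟩
    have hN' : inclPoly k N = inclPoly k (Polynomial.C (f k E)) ^ (E.l * E.t) *
        actionRat k E (MvPolynomial.X 2) := by
      rw [hN, map_sub, e3]
      simp only [map_mul, map_pow, map_sum, map_natCast]
      ring
    have hdvd : Polynomial.C (f k E) ^ (E.l * E.t) ∣ X0 * N := by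
      refine ⟨Polynomial.C (f k E) + X1 ^ E.t, hinj ?_⟩
      have e2' := sub_eq_iff_eq_add.mp e2.symm
      rw [map_mul, hN', map_mul, map_add, map_pow, map_pow, ← e2']
      ring
    have hp : Prime (Polynomial.C (f k E)) := Polynomial.prime_C_iff.mpr (prime_f k E)
    obtain ⟨M, hM⟩ := hp.pow_dvd_of_dvd_mul_left _
      (by rw [hX0]; exact not_dvd k E _) hdvd
    refine ⟨M, mul_left_cancel₀
      (pow_ne_zero (E.l * E.t) ((map_ne_zero_iff _ hinj).mpr hCf)) ?_⟩
    rw [← hN', hM, map_mul, map_pow]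
    rfl
  induction u using MvPolynomial.induction_on with
  | C a =>
    have h : actionRat k E (MvPolynomial.C a) = algebraMap k _ a := (actionRat k E).commutes a
    rw [h]
    exact (inclPoly k).range.algebraMap_mem a
  | add p q hp hq => rw [map_add]; exact (inclPoly k).range.add_mem hp hq
  | mul_X p i hp =>
    rw [map_mul]
    refine (inclPoly k).range.mul_mem hp ?_
    fin_cases i
    · exact ⟨X0, h0.symm⟩
    · exact ⟨X1, h1.symm⟩
    · exact h2

/-- The `𝔾ₐ`-action `ε : k[x₁, x₂, x₃] → k[x₁, x₂, x₃][T]`, the restriction of `actionCr`. -/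
def action (k : Type*) [Field k] (E : Exponents) : Poly k →ₐ[k] Polynomial (Poly k) :=
  (AlgEquiv.ofInjective (inclPoly k) (inclPoly_injective k)).symm.toAlgHom.comp
    ((actionRat k E).codRestrict (inclPoly k).range (actionRat_mem k E))

theorem inclPoly_action (k : Type*) [Field k] (E : Exponents) (u : Poly k) :
    inclPoly k (action k E u) = actionRat k E u :=
  congrArg Subtype.val ((AlgEquiv.ofInjective (inclPoly k) (inclPoly_injective k)).apply_symm_apply
    ((actionRat k E).codRestrict (inclPoly k).range (actionRat_mem k E) u))

/-- The ring `k[x₁, x₂, x₃]^ε` of all `u` with `ε(u) = u`. -/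
def actionInvariants (k : Type*) [Field k] (E : Exponents) : Subalgebra k (Poly k) :=
  AlgHom.equalizer (action k E) (Polynomial.CAlgHom (R := k) (A := Poly k))

/-- The map `ε_h : u ↦ ε(u)|_{T = h}` of `k[x₁, x₂, x₃]`. -/
def expAut (k : Type*) [Field k] (E : Exponents) (h : Poly k) : Poly k →ₐ[k] Poly k :=
  ((Polynomial.aeval (R := Poly k) h).restrictScalars k).comp (action k E)

/-- The ring `k[x₁, x₂, x₃]^{ε_h}` of all `u` with `ε_h(u) = u`. -/
def expInvariants (k : Type*) [Field k] (E : Exponents) (h : Poly k) : Subalgebra k (Poly k) :=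
  AlgHom.equalizer (expAut k E h) (AlgHom.id k (Poly k))

/-- `q = r ^ p - (f ^ l g h) ^ (p - 1) r`. -/
def q (k : Type*) [Field k] (E : Exponents) (p : ℕ) (h : Poly k) : Poly k :=
  r k E ^ p - (f k E ^ E.l * g k E * h) ^ (p - 1) * r k E

/-- `q₁ = g⁻¹ (f ^ (l t + 1) + q ^ (t / p))`, as an element of `k(x₁, x₂, x₃)`. -/
def q₁ (k : Type*) [Field k] (E : Exponents) (p : ℕ) (h : Poly k) : RatFun k :=
  (incl k (g k E))⁻¹ * incl k (f k E ^ (E.l * E.t + 1) + q k E p h ^ (E.t / p))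

/-- The ring `C[r ^ p]`. -/
def ringCrp (k : Type*) [Field k] (E : Exponents) (p : ℕ) : Subalgebra (ringC k E) (RatFun k) :=
  (Polynomial.aeval (R := ringC k E) (incl k (r k E) ^ p)).range

/-- `C[r ^ p]` is the polynomial ring in `r ^ p` over `C`. -/
def polyEquivCrp (k : Type*) [Field k] (E : Exponents) (p : ℕ) (hp : 0 < p) :
    Polynomial (ringC k E) ≃ₐ[ringC k E] ringCrp k E p :=
  AlgEquiv.ofInjective (Polynomial.aeval (R := ringC k E) (incl k (r k E) ^ p))
    (transcendental_iff_injective.mp ((transcendental_r k E).pow hp))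

/-- The map `ψ : C[r ^ p] → C[q] ⊆ k(x₁, x₂, x₃)`, `u(r ^ p) ↦ u(q)`, for `u` a polynomial
over `C`. -/
def psi (k : Type*) [Field k] (E : Exponents) (p : ℕ) (hp : 0 < p) (h : Poly k) :
    ringCrp k E p →ₐ[ringC k E] RatFun k :=
  (Polynomial.aeval (R := ringC k E) (incl k (q k E p h))).comp
    (polyEquivCrp k E p hp).symm.toAlgHom

end

end RankThree

namespace RankThree

open Polynomial

/-! ### The action and its specialization at `T = h` on `f`, `g`, `r`. -/

section Action

variable (k : Type*) [Field k] (E : Exponents)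

/-! Everything is controlled by reduction modulo the prime `f`. The surface `f = 0` is parametrized
by `param`, with `x₁ ↦ y` and `x₂ ↦ y z`; there `r ↦ y ^ m` and `g ↦ y ^ (m t - 1)`. Write `t = p
s`.

The invariants of `ε` are `k[f, g]` (`actionInvariants_eq`): after multiplication by a power of `f
g` an invariant is a polynomial in `r` over `k[f, g]`, invariance makes it constant in `r`, and the
factors `f` and `g` are then cancelled one at a time. So `h ∈ k[f, g]`.

Since `p ∣ t`, the difference of `q ^ s` and `r ^ t` is divisible by `f ^ l g`, so `q₁ = x₁ + f ^ l
w` is a polynomial. By Frobenius, `r ^ p - q₁ ^ (m p)` is divisible by `f ^ (l p)`, whereas the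
other term of `q` contributes `-f ^ (l (p - 1)) (g h) ^ (p - 1) r`, which need not be. Modulo `f ^
l` the factor `(g h) ^ (p - 1) r` agrees with some `q₁ c`, `c ∈ k[f, q₁]` (`exists_correction`).
Adding `f ^ (l (p - 1)) q₁ c` repairs the divisibility, and the quotient by `f ^ (l p)` is `q₂`.
Substituting in `g q₁ = f ^ (l t + 1) + q ^ s` and cancelling `q₁` modulo powers of `f` yields `q₃`
(`exists_thirdGen`).

The ring `D = k[q₁, q₂, q₃]` contains `f`, `g`, `h`, `q`; inverting `f` makes `k[x₁, x₂, x₃]`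
generated by `r` over `D`, and `r` is a root of a monic polynomial of degree `p`. This gives
algebraic independence by transcendence degree. An `ε_h`-invariant, times a power of `f`, is a
polynomial of degree less than `p` in `r` taking the same value at the `p` points `r + j f ^ l g h`,
hence lies in `D` (`eval_r_eq_coeff_zero`). The power of `f` is removed by
`mem_adjoin_of_f_mul_mem`.

For (ii), `ψ` preserves the relations between `x₁`, `x₂ ^ p`, `x₃` over `C`, so `ψ(x₁) = q₁` and `f
^ (l p) ψ(x₂ ^ p) = q - q₁ ^ (m p)`. If `f ^ l` divides `h ^ (p - 1)`, the correction `c = 0` works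
and the images are the generators. Conversely, if `ψ(x₂ ^ p)` is a polynomial, then `f ^ l` divides
`g ^ (p - 1) r h ^ (p - 1)`, hence `h ^ (p - 1)`. -/

theorem action_of_mem (u : Poly k) (hu : incl k u ∈ ringC k E) : action k E u = C u :=
  inclPoly_injective k ((inclPoly_action k E u).trans (actionRat_of_mem k E u hu))

theorem action_f : action k E (f k E) = C (f k E) := action_of_mem k E _ (f_mem k E)

theorem action_g : action k E (g k E) = C (g k E) := action_of_mem k E _ (g_mem k E)

theorem action_r : action k E (r k E) = C (r k E) + C (f k E ^ E.l * g k E) * X :=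
  inclPoly_injective k ((inclPoly_action k E _).trans (actionRat_r k E))

theorem mem_actionInvariants {u : Poly k} :
    u ∈ actionInvariants k E ↔ action k E u = C u := Iff.rfl

theorem mem_expInvariants {h u : Poly k} :
    u ∈ expInvariants k E h ↔ expAut k E h u = u := Iff.rfl

theorem expAut_apply (h u : Poly k) : expAut k E h u = (action k E u).eval h := by
  simp [expAut]

variable {k E} in
theorem expAut_of_mem (h : Poly k) {u : Poly k} (hu : u ∈ actionInvariants k E) :
    expAut k E h u = u := by
  rw [expAut_apply, (mem_actionInvariants k E).mp hu, eval_C]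

theorem f_mem_actionInvariants : f k E ∈ actionInvariants k E := action_f k E

theorem g_mem_actionInvariants : g k E ∈ actionInvariants k E := action_g k E

theorem expAut_r (h : Poly k) :
    expAut k E h (r k E) = r k E + f k E ^ E.l * g k E * h := by
  simp [expAut_apply, action_r]

end Action

/-! ### Elements of a subalgebra after inverting one element. -/

section Localize

/-- The elements of `A` that some power of `a` multiplies into the subalgebra `S`. -/
def saturation {k A : Type*} [CommRing k] [CommRing A] [Algebra k A] (S : Subalgebra k A) (a : A)
    (ha : a ∈ S) : Subalgebra k A where
  carrier := {u | ∃ n : ℕ, a ^ n * u ∈ S}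
  mul_mem' := by
    rintro u v ⟨n, hn⟩ ⟨m, hm⟩
    refine ⟨n + m, ?_⟩
    have := S.mul_mem hn hm
    rwa [show a ^ n * u * (a ^ m * v) = a ^ (n + m) * (u * v) by ring] at this
  add_mem' := by
    rintro u v ⟨n, hn⟩ ⟨m, hm⟩
    refine ⟨n + m, ?_⟩
    have := S.add_mem (S.mul_mem (S.pow_mem ha m) hn) (S.mul_mem (S.pow_mem ha n) hm)
    rwa [show a ^ m * (a ^ n * u) + a ^ n * (a ^ m * v) = a ^ (n + m) * (u + v) by ring] at this
  algebraMap_mem' c := ⟨0, by simp⟩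

variable {k A : Type*} [CommRing k] [CommRing A] [Algebra k A] {S : Subalgebra k A} {a : A}
  {ha : a ∈ S}

theorem le_saturation : S ≤ saturation S a ha := fun u hu => ⟨0, by simpa using hu⟩

theorem mem_saturation_of_mul {u : A} (hu : a * u ∈ saturation S a ha) :
    u ∈ saturation S a ha := by
  obtain ⟨n, hn⟩ := hu
  exact ⟨n + 1, by rwa [pow_succ, mul_assoc]⟩

end Localize

/-! ### Recovering the variables from `f`, `g`, `r`. -/

section Generation

variable {k : Type*} [Field k] {E : Exponents}

/-- The formulas for `r` and `g` are linear in `x₂` and `x₃`, with coefficients `f ^ l` and `f ^ (l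
t)`. So once `f` can be cancelled, only `x₁` has to be supplied. Used with `a = f g` for the
invariants of `ε` and with `a = f` for those of `ε_h`. -/
theorem mem_of_X_zero_mem {S : Subalgebra k (Poly k)} {a : Poly k} {ha : a ∈ S}
    (hf : f k E ∈ S) (hg : g k E ∈ S) (hr : r k E ∈ S)
    (hS : ∀ u, f k E * u ∈ saturation S a ha → u ∈ saturation S a ha)
    (h0 : MvPolynomial.X 0 ∈ saturation S a ha) (u : Poly k) : u ∈ saturation S a ha := by
  set T := saturation S a ha
  have hS' : ∀ (n : ℕ) u, f k E ^ n * u ∈ T → u ∈ T := by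
    intro n
    induction n with
    | zero => intro u hu; simpa using hu
    | succ n ih =>
      intro u hu
      exact hS _ (ih _ (by rwa [← mul_assoc, ← pow_succ]))
  have hfT : f k E ∈ T := le_saturation hf
  have h1 : MvPolynomial.X 1 ∈ T := by
    refine hS' E.l _ ?_
    have : f k E ^ E.l * MvPolynomial.X 1 = r k E - MvPolynomial.X 0 ^ E.m := by
      rw [r_eq]; ring
    rw [this]
    exact T.sub_mem (le_saturation hr) (T.pow_mem h0 _)
  have h2 : MvPolynomial.X 2 ∈ T := by
    refine hS' (E.l * E.t) _ ?_
    have : f k E ^ (E.l * E.t) * MvPolynomial.X 2 = g k E -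
        ∑ i ∈ Finset.range E.t, (f k E ^ E.l * MvPolynomial.X 1) ^ i *
          MvPolynomial.X 0 ^ (E.m * (E.t - i) - 1) * (E.t.choose i : Poly k) := by
      conv_rhs => rw [g_eq]
      ring
    rw [this]
    exact T.sub_mem (le_saturation hg) (T.sum_mem fun i _ => T.mul_mem (T.mul_mem (T.pow_mem
      (T.mul_mem (T.pow_mem hfT _) h1) _) (T.pow_mem h0 _)) (natCast_mem T _))
  have : (⊤ : Subalgebra k (Poly k)) ≤ T := by
    rw [← MvPolynomial.adjoin_range_X]
    refine Algebra.adjoin_le ?_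
    rintro _ ⟨i, rfl⟩
    fin_cases i
    · exact h0
    · exact h1
    · exact h2
  exact this Algebra.mem_top

end Generation

/-! ### Restriction to the surface `f = 0`. -/

section Reduction

variable (k : Type*) [Field k] (E : Exponents)

/-- The map `k[x₁, x₂, x₃] → k[y][z]`, `(x₁, x₂, x₃) ↦ (y, y z, y ^ (t - 1) z ^ t)`, which
parametrizes the surface `f = 0`. -/
noncomputable def param : Poly k →ₐ[k] k[X][X] :=
  MvPolynomial.aeval ![C X, C X * X, C (X ^ (E.t - 1)) * X ^ E.t]

theorem param_X_zero : param k E (MvPolynomial.X 0) = C X := by simp [param]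

theorem param_X_one : param k E (MvPolynomial.X 1) = C X * X := by simp [param]

theorem param_X_two : param k E (MvPolynomial.X 2) = C (X ^ (E.t - 1)) * X ^ E.t := by
  simp [param]

theorem param_f : param k E (f k E) = 0 := by
  have ht := E.two_le_t
  rw [f_eq, map_sub, map_mul, map_pow, param_X_zero, param_X_one, param_X_two]
  obtain ⟨n, hn⟩ : ∃ n, E.t = n + 1 := ⟨E.t - 1, by omega⟩
  rw [hn, Nat.add_sub_cancel]
  simp only [map_pow]
  ring

theorem param_r : param k E (r k E) = C (X ^ E.m) := by
  have hl : E.l ≠ 0 := by have := E.one_le_l; omega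
  rw [r_eq, map_add, map_mul, map_pow, map_pow, param_f, param_X_zero, zero_pow hl]
  simp

theorem param_g : param k E (g k E) = C (X ^ (E.m * E.t - 1)) := by
  have h := congrArg (param k E) (X_zero_mul_g k E)
  have hmt := E.three_le_mt
  rw [map_mul, map_add, map_pow, map_pow, param_f, param_r, param_X_zero,
    zero_pow (Nat.succ_ne_zero _), zero_add, ← map_pow, ← pow_mul] at h
  refine mul_left_cancel₀ (a := (C X : k[X][X])) (by simp) ?_
  rw [h, ← map_mul, ← pow_succ']
  congr 2
  omega

/-- The elements of `k[x₁, x₂, x₃]` whose restriction to `f = 0` is a polynomial in `x₁`. -/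
noncomputable def baseRing : Subalgebra k (Poly k) :=
  (Polynomial.CAlgHom (R := k) (A := k[X])).range.comap (param k E)

theorem mem_baseRing {u : Poly k} : u ∈ baseRing k E ↔ ∃ a, C a = param k E u := Iff.rfl

theorem X_zero_mem_baseRing : MvPolynomial.X 0 ∈ baseRing k E :=
  ⟨X, (param_X_zero k E).symm⟩

theorem f_mul_mem_baseRing (u : Poly k) : f k E * u ∈ baseRing k E :=
  (mem_baseRing k E).mpr ⟨0, by rw [map_mul, param_f]; simp⟩

theorem f_mem_baseRing : f k E ∈ baseRing k E := by
  simpa using f_mul_mem_baseRing k E 1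

theorem g_mem_baseRing : g k E ∈ baseRing k E := ⟨_, (param_g k E).symm⟩

theorem r_mem_baseRing : r k E ∈ baseRing k E := ⟨_, (param_r k E).symm⟩

theorem adjoin_f_g_le_baseRing : Algebra.adjoin k {f k E, g k E} ≤ baseRing k E := by
  refine Algebra.adjoin_le ?_
  rintro _ (rfl | rfl)
  · exact f_mem_baseRing k E
  · exact g_mem_baseRing k E

variable {k E} in
theorem not_f_dvd {u : Poly k} (hu : param k E u ≠ 0) : ¬ f k E ∣ u := by
  rintro ⟨v, rfl⟩
  exact hu (by rw [map_mul, param_f, zero_mul])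

end Reduction

end RankThree

namespace RankThree

open Polynomial

/-! ### Cancelling a generator inside an algebra on two generators. -/

section Descent

variable {k A B : Type*} [Field k] [CommRing A] [Algebra k A] [CommRing B]
  [Algebra k B]

/-- Separates the monomials in `c, d` that contain `c` from the pure powers of `d`. -/
theorem exists_eq_mul_add_aeval {c d a : A} (ha : a ∈ Algebra.adjoin k {c, d}) :
    ∃ b ∈ Algebra.adjoin k {c, d}, ∃ P : k[X], a = c * b + aeval d P := by
  have hc : c ∈ Algebra.adjoin k {c, d} := Algebra.subset_adjoin (by simp)
  have hd : ∀ P : k[X], aeval d P ∈ Algebra.adjoin k {c, d} := fun P =>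
    Algebra.adjoin_mono (by simp) (aeval_mem_adjoin_singleton k d)
  induction ha using Algebra.adjoin_induction with
  | mem x hx =>
    rcases hx with rfl | rfl
    · exact ⟨1, one_mem _, 0, by simp⟩
    · exact ⟨0, zero_mem _, X, by simp⟩
  | algebraMap z => exact ⟨0, zero_mem _, C z, by simp⟩
  | add x y _ _ hx hy =>
    obtain ⟨b, hb, P, rfl⟩ := hx
    obtain ⟨b', hb', P', rfl⟩ := hy
    exact ⟨b + b', add_mem hb hb', P + P', by rw [map_add]; ring⟩
  | mul x y _ _ hx hy =>
    obtain ⟨b, hb, P, rfl⟩ := hx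
    obtain ⟨b', hb', P', rfl⟩ := hy
    refine ⟨c * b * b' + b * aeval d P' + b' * aeval d P, add_mem (add_mem (mul_mem
      (mul_mem hc hb) hb') (mul_mem hb (hd P'))) (mul_mem hb' (hd P)), P * P', ?_⟩
    rw [map_mul]
    ring

/-- If `c` vanishes and `d` is transcendental under some homomorphism, then `k[c, d]` contains
the quotients of its elements by `c`. -/
theorem mem_adjoin_of_mul_mem [IsDomain A] (φ : A →ₐ[k] B) {c d u : A} (hc0 : c ≠ 0) (hc : φ c = 0)
    (hd : Transcendental k (φ d)) (hu : c * u ∈ Algebra.adjoin k {c, d}) :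
    u ∈ Algebra.adjoin k {c, d} := by
  obtain ⟨b, hb, P, h⟩ := exists_eq_mul_add_aeval hu
  have hP : aeval (φ d) P = 0 := by
    have := congrArg φ h
    rw [map_mul, map_add, map_mul, hc, zero_mul, zero_mul, zero_add] at this
    rw [aeval_algHom_apply, ← this]
  have : P = 0 := (transcendental_iff.mp hd) P hP
  rw [this, map_zero, add_zero] at h
  rwa [mul_left_cancel₀ hc0 h]

end Descent

/-! ### The invariants of `ε` are `k[f, g]`. -/

section Invariants

variable {k : Type*} [Field k] {E : Exponents}

/-- With `f g` inverted, `x₁ = g⁻¹ (f ^ (l t + 1) + r ^ t)` is a polynomial in `r`, and the other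
variables follow. -/
theorem exists_pow_mul_eq_aeval (u : Poly k) :
    ∃ (n : ℕ) (U : (Algebra.adjoin k {f k E, g k E})[X]),
      (f k E * g k E) ^ n * u = aeval (r k E) U := by
  let R := Algebra.adjoin k {f k E, g k E}
  have hfR : f k E ∈ R := Algebra.subset_adjoin (by simp)
  have hgR : g k E ∈ R := Algebra.subset_adjoin (by simp)
  let S : Subalgebra k (Poly k) := (aeval (R := R) (r k E)).range.restrictScalars k
  have hRS : ∀ c ∈ R, c ∈ S := fun c hc => ⟨C ⟨c, hc⟩, by simp⟩
  have hr : r k E ∈ S := ⟨X, by simp⟩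
  have ha : f k E * g k E ∈ S := hRS _ (R.mul_mem hfR hgR)
  have key : u ∈ saturation S _ ha := by
    refine mem_of_X_zero_mem (hRS _ hfR) (hRS _ hgR) hr (fun v hv => ?_) ?_ u
    · refine mem_saturation_of_mul ?_
      rw [show f k E * g k E * v = g k E * (f k E * v) by ring]
      exact mul_mem (le_saturation (hRS _ hgR)) hv
    · refine mem_saturation_of_mul ?_
      rw [show f k E * g k E * MvPolynomial.X 0 = f k E * (MvPolynomial.X 0 * g k E) by ring,
        X_zero_mul_g]
      exact le_saturation (S.mul_mem (hRS _ hfR) (S.add_mem (S.pow_mem (hRS _ hfR) _)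
        (S.pow_mem hr _)))
  obtain ⟨n, U, hU⟩ := key
  exact ⟨n, U, hU.symm⟩

theorem adjoin_f_g_le_actionInvariants :
    Algebra.adjoin k {f k E, g k E} ≤ actionInvariants k E := by
  refine Algebra.adjoin_le ?_
  rintro _ (rfl | rfl)
  · exact f_mem_actionInvariants k E
  · exact g_mem_actionInvariants k E

theorem action_eval_r {V : (Poly k)[X]} (hV : ∀ n, V.coeff n ∈ actionInvariants k E) :
    action k E (V.eval (r k E)) = V.comp (C (r k E) + C (f k E ^ E.l * g k E) * X) := by
  rw [comp, eval₂_eq_sum_range, eval_eq_sum_range, map_sum]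
  refine Finset.sum_congr rfl fun i _ => ?_
  rw [map_mul, map_pow, action_r, (mem_actionInvariants k E).mp (hV i)]

theorem transcendental_param_g :
    Transcendental k (param k E (g k E)) := by
  have hmt := E.three_le_mt
  rw [param_g]
  have := (Polynomial.transcendental_X k).pow (n := E.m * E.t - 1) (by omega)
  exact (transcendental_algebraMap_iff (R := k) (S := k[X]) (A := k[X][X]) C_injective).mpr this

variable (k E) in
/-- The map `k[x₁, x₂, x₃] → k[y]`, `(x₁, x₂, x₃) ↦ (0, y, 0)`. -/
noncomputable def line : Poly k →ₐ[k] k[X] := MvPolynomial.aeval ![0, X, 0]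

theorem line_f : line k (f k E) = -X ^ E.t := by simp [line, f_eq]

/-- Every summand of `g` contains `x₁` or `x₃` except, when `m = 1`, the one with `i = t - 1`; its
binomial coefficient is `t`, which is zero in `k`. -/
theorem line_g (ht : (E.t : k) = 0) : line k (g k E) = 0 := by
  have h0 : line k (MvPolynomial.X 0) = 0 := by simp [line]
  have h2 : line k (MvPolynomial.X 2) = 0 := by simp [line]
  rw [g_eq, map_add, map_mul, h2, mul_zero, zero_add, map_sum]
  refine Finset.sum_eq_zero fun i hi => ?_
  rw [map_mul, map_mul, map_pow _ (MvPolynomial.X 0), h0, map_natCast]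
  have hi' := Finset.mem_range.mp hi
  have hm := E.one_le_m
  by_cases h : E.m * (E.t - i) - 1 = 0
  · have h1 : E.m * (E.t - i) ≤ 1 := by omega
    have h3 : E.t - i ≤ 1 := (Nat.le_mul_of_pos_left _ hm).trans h1
    obtain ⟨n, hn⟩ : ∃ n, E.t = n + 1 := ⟨E.t - 1, by omega⟩
    have hin : i = n := by omega
    have hc : E.t.choose i = E.t := by rw [hin, hn, Nat.choose_succ_self_right]
    have : (E.t : k[X]) = 0 := by rw [← map_natCast (C : k →+* k[X]), ht, map_zero]
    rw [hc, this, mul_zero]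
  · rw [zero_pow h, mul_zero, zero_mul]

theorem transcendental_line_f : Transcendental k (line k (f k E)) := by
  have ht := E.two_le_t
  rw [line_f]
  intro h
  have := h.neg
  rw [neg_neg] at this
  exact (Polynomial.transcendental_X k).pow (n := E.t) (by omega) this

/-- The ring of invariants of `ε` is `k[f, g]`. -/
theorem actionInvariants_eq (ht : (E.t : k) = 0) :
    actionInvariants k E = Algebra.adjoin k {f k E, g k E} := by
  refine le_antisymm (fun u hu => ?_) adjoin_f_g_le_actionInvariants
  obtain ⟨n, U, hU⟩ := exists_pow_mul_eq_aeval (E := E) u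
  have hV := action_eval_r (E := E)
    (V := U.map (algebraMap (Algebra.adjoin k {f k E, g k E}) (Poly k)))
    (fun n => by rw [coeff_map]; exact adjoin_f_g_le_actionInvariants (U.coeff n).2)
  have hfg : (f k E * g k E) ^ n * u ∈ actionInvariants k E :=
    mul_mem (pow_mem (mul_mem (f_mem_actionInvariants k E) (g_mem_actionInvariants k E)) n) hu
  rw [eval_map_algebraMap, ← hU, (mem_actionInvariants k E).mp hfg] at hV
  -- The left side is constant in `T`, while substituting a linear polynomial with nonzero leading
  -- coefficient preserves the degree. So `U` is constant.
  have hdeg := congrArg natDegree hV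
  have hb : f k E ^ E.l * g k E ≠ 0 := mul_ne_zero (pow_ne_zero _ (f_ne_zero k E)) (g_ne_zero k E)
  rw [natDegree_C, natDegree_comp, add_comm (C (r k E)), natDegree_linear hb, mul_one,
    natDegree_map_eq_of_injective Subtype.val_injective] at hdeg
  rw [eq_C_of_natDegree_eq_zero hdeg.symm, aeval_C] at hU
  have hmem : (f k E * g k E) ^ n * u ∈ Algebra.adjoin k {f k E, g k E} := by
    rw [hU]; exact (U.coeff 0).2
  clear hU hV hdeg hfg
  induction n with
  | zero => simpa using hmem
  | succ n ih =>
    refine ih ?_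
    -- One factor `f` is cancelled by `param`, where `g` stays transcendental; then one factor `g`
    -- by `line`, where `f` does.
    have h1 : g k E * ((f k E * g k E) ^ n * u) ∈ Algebra.adjoin k {f k E, g k E} := by
      refine mem_adjoin_of_mul_mem (param k E) (f_ne_zero k E) (param_f k E)
        transcendental_param_g ?_
      rwa [← mul_assoc, ← mul_assoc, ← pow_succ']
    rw [Set.pair_comm] at h1 ⊢
    exact mem_adjoin_of_mul_mem (line k) (g_ne_zero k E) (line_g ht) transcendental_line_f h1

end Invariants

end RankThree

namespace RankThree

open Polynomial

theorem exists_prime_eq_add_two {p : ℕ} (hp : p.Prime) : ∃ n, p = n + 2 :=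
  ⟨p - 2, by have := hp.two_le; omega⟩

/-! ### Congruences of powers with remainders in a subalgebra. -/

section Subalgebra

variable {k A : Type*} [CommRing k] [CommRing A] [Algebra k A] (S : Subalgebra k A)

theorem geom_sum_mem {a b : A} (ha : a ∈ S) (hb : b ∈ S) (n : ℕ) :
    ∑ i ∈ Finset.range n, a ^ i * b ^ (n - 1 - i) ∈ S :=
  S.sum_mem fun _ _ => S.mul_mem (S.pow_mem ha _) (S.pow_mem hb _)

theorem exists_pow_eq_add_mul {a b c w : A} (ha : a ∈ S) (hb : b ∈ S) (hw : w ∈ S)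
    (h : a = b + c * w) (n : ℕ) : ∃ v ∈ S, a ^ n = b ^ n + c * v := by
  refine ⟨_, S.mul_mem (geom_sum_mem S ha hb n) hw, ?_⟩
  have := geom_sum₂_mul a b n
  rw [show a - b = c * w by rw [h]; ring] at this
  linear_combination -this

end Subalgebra

/-! ### The generators `q₁` and `q₂`. -/

section FirstGenerator

variable {k : Type*} [Field k]

/-- The polynomial `w` with `q₁ = x₁ + f ^ l w`. -/
noncomputable def tailPoly (E : Exponents) (p s : ℕ) (h : Poly k) : Poly k :=
  -(f k E ^ (E.l * (p - 2)) * g k E ^ (p - 2) * h ^ (p - 1) * r k E *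
    ∑ i ∈ Finset.range s, q k E p h ^ i * (r k E ^ p) ^ (s - 1 - i))

/-- The polynomial `q₁ = g⁻¹ (f ^ (l t + 1) + q ^ s)`. -/
noncomputable def firstGen (E : Exponents) (p s : ℕ) (h : Poly k) : Poly k :=
  MvPolynomial.X 0 + f k E ^ E.l * tailPoly E p s h

variable {E : Exponents} {p s : ℕ} {h : Poly k}

theorem q_mem {S : Subalgebra k (Poly k)} (hf : f k E ∈ S) (hg : g k E ∈ S) (hr : r k E ∈ S)
    (hh : h ∈ S) : q k E p h ∈ S :=
  S.sub_mem (S.pow_mem hr _) (S.mul_mem (S.pow_mem (S.mul_mem (S.mul_mem (S.pow_mem hf _) hg) hh)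
    _) hr)

theorem tailPoly_mem {S : Subalgebra k (Poly k)} (hf : f k E ∈ S) (hg : g k E ∈ S)
    (hr : r k E ∈ S) (hh : h ∈ S) : tailPoly E p s h ∈ S :=
  S.neg_mem (S.mul_mem (S.mul_mem (S.mul_mem (S.mul_mem (S.pow_mem hf _) (S.pow_mem hg _))
    (S.pow_mem hh _)) hr) (geom_sum_mem S (q_mem hf hg hr hh) (S.pow_mem hr _) _))

/-- The difference `q - r ^ p = -(f ^ l g h) ^ (p - 1) r` divides `q ^ s - r ^ t`. As `p ≥ 2`, one
factor `f ^ l g` splits off; the remaining cofactor is `tailPoly`. -/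
theorem g_mul_firstGen (hp : p.Prime) (hts : E.t = p * s) :
    g k E * firstGen E p s h = f k E ^ (E.l * E.t + 1) + q k E p h ^ s := by
  obtain ⟨n, rfl⟩ := exists_prime_eq_add_two hp
  have h1 := X_zero_mul_g k E
  have h2 := geom_sum₂_mul (q k E (n + 2) h) (r k E ^ (n + 2)) s
  rw [hts, pow_mul (r k E), ← hts] at h1
  rw [show q k E (n + 2) h - r k E ^ (n + 2) = -((f k E ^ E.l * g k E * h) ^ (n + 1) * r k E) by
    rw [q]; simp] at h2
  rw [firstGen, tailPoly]
  simp only [show n + 2 - 2 = n by omega, show n + 2 - 1 = n + 1 by omega, pow_mul, mul_pow] at h2 ⊢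
  linear_combination h1 + h2

theorem param_firstGen : param k E (firstGen E p s h) = C X := by
  have hl : E.l ≠ 0 := by have := E.one_le_l; omega
  rw [firstGen, map_add, map_mul, map_pow, param_f, zero_pow hl, zero_mul, add_zero, param_X_zero]

theorem incl_firstGen (hp : p.Prime) (hts : E.t = p * s) :
    incl k (firstGen E p s h) = q₁ k E p h := by
  have hg : incl k (g k E) ≠ 0 := by simpa using g_ne_zero k E
  have hs : E.t / p = s := by rw [hts, Nat.mul_div_cancel_left _ hp.pos]
  rw [q₁, hs, ← g_mul_firstGen hp hts, map_mul, inv_mul_cancel_left₀ hg]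

theorem r_pow [CharP k p] (hp : p.Prime) :
    r k E ^ p = f k E ^ (E.l * p) * MvPolynomial.X 1 ^ p + MvPolynomial.X 0 ^ (E.m * p) := by
  have := Fact.mk hp
  rw [r_eq, add_pow_char, mul_pow, ← pow_mul, ← pow_mul]

/-- `g ≡ x₁ ^ (m t - 1)` modulo `f ^ (l p)`. -/
theorem exists_g_eq [CharP k p] (hp : p.Prime) (hts : E.t = p * s) :
    ∃ c, g k E = MvPolynomial.X 0 ^ (E.m * E.t - 1) + f k E ^ (E.l * p) * c := by
  -- The factor `x₁` makes `x₁ g = f ^ (l t + 1) + r ^ t` applicable; it is cancelled afterwards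
  -- because the prime `f` does not divide `x₁`.
  have hdvd : f k E ^ (E.l * p) ∣
      MvPolynomial.X 0 * (g k E - MvPolynomial.X 0 ^ (E.m * E.t - 1)) := by
    have hmt := E.three_le_mt
    have h2 := E.two_le_t
    have hs : 1 ≤ s := by
      rcases Nat.eq_zero_or_pos s with rfl | h
      · rw [mul_zero] at hts; omega
      · exact h
    have h1 : MvPolynomial.X 0 * (g k E - MvPolynomial.X 0 ^ (E.m * E.t - 1)) =
        f k E ^ (E.l * E.t + 1) +
          ((r k E ^ p) ^ s - (MvPolynomial.X 0 ^ (E.m * p)) ^ s) := by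
      rw [mul_sub, X_zero_mul_g, ← pow_succ', ← pow_mul, ← pow_mul, mul_assoc, ← hts,
        Nat.sub_add_cancel (by omega)]
      ring
    rw [h1]
    have h3 : f k E ^ (E.l * p) ∣ r k E ^ p - MvPolynomial.X 0 ^ (E.m * p) :=
      ⟨MvPolynomial.X 1 ^ p, by rw [r_pow hp]; ring⟩
    refine dvd_add (pow_dvd_pow _ ?_) (h3.trans (sub_dvd_pow_sub_pow _ _ s))
    have : E.l * p ≤ E.l * E.t :=
      Nat.mul_le_mul_left _ (by rw [hts]; exact Nat.le_mul_of_pos_right _ hs)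
    omega
  obtain ⟨c, hc⟩ := (prime_f k E).pow_dvd_of_dvd_mul_left _
    (not_f_dvd (by rw [param_X_zero]; simp)) hdvd
  exact ⟨c, by rw [← hc]; ring⟩

theorem tailPoly_mem_baseRing (hh : h ∈ Algebra.adjoin k {f k E, g k E}) :
    tailPoly E p s h ∈ baseRing k E :=
  tailPoly_mem (f_mem_baseRing k E) (g_mem_baseRing k E) (r_mem_baseRing k E)
    (adjoin_f_g_le_baseRing k E hh)

theorem firstGen_mem_baseRing : firstGen E p s h ∈ baseRing k E :=
  ⟨X, param_firstGen.symm⟩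

theorem exists_firstGen_pow_eq (hh : h ∈ Algebra.adjoin k {f k E, g k E}) (n : ℕ) :
    ∃ v ∈ baseRing k E, firstGen E p s h ^ n = MvPolynomial.X 0 ^ n + f k E ^ E.l * v :=
  exists_pow_eq_add_mul _ firstGen_mem_baseRing (X_zero_mem_baseRing k E)
    (tailPoly_mem_baseRing hh) rfl n

/-- Modulo `f ^ l`, the elements of `k[f, g]` are polynomials in `f` and `q₁`. -/
theorem exists_eq_add_mul_of_mem_adjoin [CharP k p] (hp : p.Prime) (hts : E.t = p * s)
    (hh : h ∈ Algebra.adjoin k {f k E, g k E}) {a : Poly k}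
    (ha : a ∈ Algebra.adjoin k {f k E, g k E}) :
    ∃ a' ∈ Algebra.adjoin k {f k E, firstGen E p s h}, ∃ v ∈ baseRing k E,
      a = a' + f k E ^ E.l * v := by
  set T := Algebra.adjoin k {f k E, firstGen E p s h}
  have hfT : f k E ∈ T := Algebra.subset_adjoin (by simp)
  have hqT : firstGen E p s h ∈ T := Algebra.subset_adjoin (by simp)
  have hfM := f_mem_baseRing k E
  have hTM : T ≤ baseRing k E := by
    refine Algebra.adjoin_le ?_
    rintro _ (rfl | rfl)
    · exact hfM
    · exact firstGen_mem_baseRing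
  induction ha using Algebra.adjoin_induction with
  | mem x hx =>
    rcases hx with rfl | rfl
    · exact ⟨_, hfT, 0, zero_mem _, by ring⟩
    · obtain ⟨c, hc⟩ := exists_g_eq hp hts (k := k)
      obtain ⟨v, hv, hv'⟩ := exists_firstGen_pow_eq (p := p) (s := s) hh (E.m * E.t - 1)
      obtain ⟨n, rfl⟩ := exists_prime_eq_add_two hp
      obtain ⟨d, hd⟩ : ∃ d, E.l = d + 1 := ⟨E.l - 1, by have := E.one_le_l; omega⟩
      refine ⟨_, T.pow_mem hqT (E.m * E.t - 1), _,
        sub_mem (f_mul_mem_baseRing k E (f k E ^ (d + E.l * n) * c)) hv, ?_⟩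
      rw [hv']
      conv_lhs => rw [hc]
      -- Since `l p > l`, a factor `f` is left over. It puts the remainder in `baseRing` although
      -- nothing is known about `c`.
      have : f k E ^ (E.l * (n + 2)) = f k E ^ E.l * (f k E * f k E ^ (d + E.l * n)) := by
        rw [← pow_succ', ← pow_add]
        congr 1
        rw [mul_add]
        omega
      rw [this]
      ring
  | algebraMap z => exact ⟨_, T.algebraMap_mem z, 0, zero_mem _, by ring⟩
  | add x y _ _ hx hy =>
    obtain ⟨a, ha, v, hv, rfl⟩ := hx
    obtain ⟨b, hb, w, hw, rfl⟩ := hy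
    exact ⟨_, T.add_mem ha hb, _, add_mem hv hw, by ring⟩
  | mul x y _ _ hx hy =>
    obtain ⟨a, ha, v, hv, rfl⟩ := hx
    obtain ⟨b, hb, w, hw, rfl⟩ := hy
    exact ⟨_, T.mul_mem ha hb, _, add_mem (add_mem (mul_mem (hTM ha) hw) (mul_mem (hTM hb) hv))
      (mul_mem (mul_mem (pow_mem hfM E.l) hv) hw), by ring⟩

/-- Modulo `f ^ l`, the element `(g h) ^ (p - 1) r` is a multiple of `q₁` in `k[f, q₁]`. -/
theorem exists_correction [CharP k p] (hp : p.Prime) (hts : E.t = p * s)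
    (hh : h ∈ Algebra.adjoin k {f k E, g k E}) :
    ∃ c ∈ Algebra.adjoin k {f k E, firstGen E p s h}, ∃ a ∈ baseRing k E, ∃ v ∈ baseRing k E,
      (g k E * h) ^ (p - 1) * r k E - firstGen E p s h * c =
        f k E ^ E.l * (a * MvPolynomial.X 1 + v) := by
  have hgh : (g k E * h) ^ (p - 1) ∈ Algebra.adjoin k {f k E, g k E} :=
    pow_mem (mul_mem (Algebra.subset_adjoin (by simp)) hh) _
  obtain ⟨a, ha, v, hv, h1⟩ := exists_eq_add_mul_of_mem_adjoin hp hts hh hgh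
  obtain ⟨w, hw, h2⟩ := exists_firstGen_pow_eq (p := p) (s := s) hh E.m
  obtain ⟨n, hn⟩ : ∃ n, E.m = n + 1 := ⟨E.m - 1, by have := E.one_le_m; omega⟩
  have hq := firstGen_mem_baseRing (k := k) (E := E) (p := p) (s := s) (h := h)
  -- Modulo `f ^ l`, `(g h) ^ (p - 1) ≡ a` and `r ≡ x₁ ^ m ≡ q₁ ^ m`; one factor `q₁` is set aside,
  -- which uses `m ≥ 1`. The coefficient of `x₂` comes from the term `f ^ l x₂` of `r`.
  refine ⟨a * firstGen E p s h ^ n, mul_mem ha (pow_mem (Algebra.subset_adjoin (by simp)) _),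
    (g k E * h) ^ (p - 1), adjoin_f_g_le_baseRing k E hgh,
    v * firstGen E p s h ^ E.m - (g k E * h) ^ (p - 1) * w,
    sub_mem (mul_mem hv (pow_mem hq _)) (mul_mem (adjoin_f_g_le_baseRing k E hgh) hw), ?_⟩
  have h3 : firstGen E p s h * (a * firstGen E p s h ^ n) = a * firstGen E p s h ^ E.m := by
    rw [hn]; ring
  have h4 : a = (g k E * h) ^ (p - 1) - f k E ^ E.l * v := by rw [h1]; ring
  rw [h3, r_eq, h4]
  linear_combination -(g k E * h) ^ (p - 1) * h2

/-- The second generator, from a correction term. -/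
theorem exists_secondGen [CharP k p] (hp : p.Prime)
    (hh : h ∈ Algebra.adjoin k {f k E, g k E}) {c a v : Poly k}
    (ha : a ∈ baseRing k E) (hv : v ∈ baseRing k E)
    (hc : (g k E * h) ^ (p - 1) * r k E - firstGen E p s h * c =
        f k E ^ E.l * (a * MvPolynomial.X 1 + v)) :
    ∃ q₂ : Poly k, f k E ^ (E.l * p) * q₂ = q k E p h - firstGen E p s h ^ (E.m * p) +
        f k E ^ (E.l * (p - 1)) * (firstGen E p s h * c) ∧ 0 < (param k E q₂).natDegree := by
  have := Fact.mk hp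
  obtain ⟨w, hw, h2⟩ := exists_firstGen_pow_eq (p := p) (s := s) hh E.m
  -- By Frobenius, `x₂ ^ p - w ^ p` is `r ^ p - q₁ ^ (m p)` divided by `f ^ (l p)`; the last bracket
  -- is the corrected remainder divided likewise.
  refine ⟨MvPolynomial.X 1 ^ p - w ^ p - (a * MvPolynomial.X 1 + v), ?_, ?_⟩
  · have h3 : firstGen E p s h ^ (E.m * p) =
        MvPolynomial.X 0 ^ (E.m * p) + f k E ^ (E.l * p) * w ^ p := by
      rw [pow_mul, h2, add_pow_char, mul_pow, ← pow_mul, ← pow_mul]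
    have h4 : f k E ^ (E.l * p) = f k E ^ (E.l * (p - 1)) * f k E ^ E.l := by
      rw [← pow_add, ← Nat.mul_succ, Nat.succ_eq_add_one, Nat.sub_add_cancel hp.one_le]
    rw [q, r_pow hp, h3, mul_assoc (f k E ^ E.l), mul_pow (f k E ^ E.l), ← pow_mul (f k E) E.l]
    linear_combination f k E ^ (E.l * (p - 1)) * hc -
      (a * MvPolynomial.X 1 + v) * h4
  · obtain ⟨a', ha'⟩ := (mem_baseRing k E).mp ha
    obtain ⟨v', hv'⟩ := (mem_baseRing k E).mp hv
    obtain ⟨w', hw'⟩ := (mem_baseRing k E).mp hw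
    -- The coefficient of `z ^ p` is `y ^ p`: elements of `baseRing` restrict to constants in `z`,
    -- so the subtracted terms have degree at most `1 < p`.
    refine hp.pos.trans_le (le_natDegree_of_ne_zero ?_)
    have : param k E (MvPolynomial.X 1 ^ p - w ^ p - (a * MvPolynomial.X 1 + v)) =
        C (X ^ p) * X ^ p - C (w' ^ p + v') - C (a' * X) * X := by
      simp only [map_sub, map_add, map_mul, map_pow, param_X_one, ← ha', ← hv', ← hw']
      ring
    rw [this, coeff_sub, coeff_sub, coeff_C_mul, coeff_C_mul, coeff_X_pow_self,
      coeff_C_of_ne_zero hp.ne_zero, coeff_X_of_ne_one hp.ne_one]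
    simp

end FirstGenerator

end RankThree

namespace RankThree

open Polynomial

theorem range_vec_three {α : Type*} (a b c : α) : Set.range ![a, b, c] = {a, b, c} := by
  simp only [Matrix.range_cons, Matrix.range_empty, Set.union_empty, Set.singleton_union]

/-! ### Cancelling `f` inside `k[q₁, q₂, q₃]`. -/

section Descent

variable {k : Type*} [Field k] {E : Exponents}

/-- Linear in `x₃` with coprime coefficients. This polynomial represents `f` in the coordinates `q₁,
q₂, q₃`. -/
theorem prime_X_zero_mul_X_two_sub (s : ℕ) :
    Prime (MvPolynomial.X 0 * MvPolynomial.X 2 - MvPolynomial.X 1 ^ s : Poly k) := by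
  have h := MvPolynomial.irreducible_mul_X_add (R := k) (MvPolynomial.X (0 : Fin 3))
    (-MvPolynomial.X 1 ^ s) 2 (by simp) (by simp [MvPolynomial.vars_X]) (by
      intro h2
      rw [MvPolynomial.vars_neg] at h2
      have := MvPolynomial.vars_pow _ _ h2
      simp [MvPolynomial.vars_X] at this) (by
      refine (Irreducible.isRelPrime_iff_not_dvd
        (MvPolynomial.X_prime (R := k) (i := (0 : Fin 3))).irreducible).mpr ?_
      rintro ⟨c, hc⟩
      have := congrArg (MvPolynomial.eval (![0, 1, 0] : Fin 3 → k)) hc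
      simp at this)
  rw [sub_eq_add_neg]
  exact h.prime

/-- If `q₁, q₂, q₃` are algebraically independent with `q₁ q₃ - q₂ ^ s = f`, and `q₁, q₂` stay
algebraically independent modulo `f`, then `f` divides an element of `k[q₁, q₂, q₃]` there if it
divides it in `k[x₁, x₂, x₃]`. -/
theorem mem_adjoin_of_f_mul_mem {q₁ q₂ q₃ : Poly k} {s : ℕ}
    (hind : AlgebraicIndependent k ![q₁, q₂, q₃]) (hf : q₁ * q₃ - q₂ ^ s = f k E)
    (h1 : param k E q₁ = C X) (h2 : 0 < (param k E q₂).natDegree) {u : Poly k}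
    (hu : f k E * u ∈ Algebra.adjoin k {q₁, q₂, q₃}) : u ∈ Algebra.adjoin k {q₁, q₂, q₃} := by
  set D := Algebra.adjoin k {q₁, q₂, q₃} with hD
  have m1 : q₁ ∈ D := Algebra.subset_adjoin (by simp)
  have m2 : q₂ ∈ D := Algebra.subset_adjoin (by simp)
  have m3 : q₃ ∈ D := Algebra.subset_adjoin (by simp)
  have mf : f k E ∈ D := hf ▸ D.sub_mem (D.mul_mem m1 m3) (D.pow_mem m2 s)
  let ev : k[X][X] →+* Poly k := eval₂RingHom (aeval q₁ : k[X] →ₐ[k] Poly k).toRingHom q₂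
  have hevD : ∀ P, ev P ∈ D := fun P => by
    change eval₂ _ q₂ P ∈ D
    rw [eval₂_eq_sum_range]
    exact D.sum_mem fun i _ => D.mul_mem
      (Algebra.adjoin_mono (by simp) (aeval_mem_adjoin_singleton k q₁)) (D.pow_mem m2 _)
  have hev : ∀ P, param k E (ev P) = P.comp (param k E q₂) := by
    have : (param k E).toRingHom.comp ev = compRingHom (param k E q₂) := by
      refine ringHom_ext (fun a => ?_) (by simp [ev])
      have : (param k E).comp (aeval q₁) = (CAlgHom : k[X] →ₐ[k] k[X][X]) := by
        ext
        simp [h1]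
      simpa [ev] using DFunLike.congr_fun this a
    exact fun P => DFunLike.congr_fun this P
  -- As `q₁ q₃ = q₂ ^ s + f`, powers of `q₁` eliminate `q₃` modulo `f D`.
  have key : ∀ a ∈ D, ∃ (n : ℕ) (P : k[X][X]) (d : Poly k), d ∈ D ∧
      q₁ ^ n * a = ev P + f k E * d := by
    intro a ha
    have e1 : ev (C X) = q₁ := by simp [ev]
    have e2 : ev X = q₂ := by simp [ev]
    induction ha using Algebra.adjoin_induction with
    | mem x hx =>
      rcases hx with rfl | rfl | rfl
      · exact ⟨0, C X, 0, zero_mem _, by rw [e1]; ring⟩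
      · exact ⟨0, X, 0, zero_mem _, by rw [e2]; ring⟩
      · refine ⟨1, X ^ s, 1, one_mem _, ?_⟩
        rw [map_pow, e2, ← hf]; ring
    | algebraMap z => exact ⟨0, C (C z), 0, zero_mem _, by simp [ev, MvPolynomial.algebraMap_eq]⟩
    | add x y hx hy ihx ihy =>
      obtain ⟨n, P, d, hd, hP⟩ := ihx
      obtain ⟨m, Q, e, he, hQ⟩ := ihy
      refine ⟨n + m, C X ^ m * P + C X ^ n * Q, q₁ ^ m * d + q₁ ^ n * e,
        D.add_mem (D.mul_mem (D.pow_mem m1 _) hd) (D.mul_mem (D.pow_mem m1 _) he), ?_⟩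
      rw [map_add, map_mul, map_mul, map_pow, map_pow, e1]
      linear_combination q₁ ^ m * hP + q₁ ^ n * hQ
    | mul x y hx hy ihx ihy =>
      obtain ⟨n, P, d, hd, hP⟩ := ihx
      obtain ⟨m, Q, e, he, hQ⟩ := ihy
      refine ⟨n + m, P * Q, d * ev Q + e * ev P + f k E * (d * e), D.add_mem (D.add_mem
        (D.mul_mem hd (hevD _)) (D.mul_mem he (hevD _))) (D.mul_mem mf (D.mul_mem hd he)), ?_⟩
      rw [map_mul]
      linear_combination q₁ ^ m * y * hP + (ev P + f k E * d) * hQ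
  obtain ⟨n, P, d, hd, hP⟩ := key _ hu
  -- On `f = 0` the relation says that `P` vanishes when its outer variable is replaced by the
  -- restriction of `q₂`, which is nonconstant in `z`.
  have hP0 : P = 0 := by
    have := congrArg (param k E) hP
    rw [map_mul, map_mul, map_add, map_mul, param_f, hev, zero_mul, zero_mul, mul_zero,
      add_zero] at this
    rcases comp_eq_zero_iff.mp this.symm with h | ⟨-, h⟩
    · exact h
    · rw [h, natDegree_C] at h2
      exact absurd h2 (lt_irrefl _)
  rw [hP0, map_zero, zero_add] at hP
  have hrange : ∀ x, x ∈ D ↔ ∃ P, MvPolynomial.aeval ![q₁, q₂, q₃] P = x := fun x => by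
    rw [hD, ← range_vec_three, Algebra.adjoin_range_eq_range_aeval]
    rfl
  obtain ⟨U, hU⟩ := (hrange _).mp hu
  obtain ⟨V, hV⟩ := (hrange _).mp hd
  have hF : MvPolynomial.aeval ![q₁, q₂, q₃] (MvPolynomial.X 0 * MvPolynomial.X 2 -
      MvPolynomial.X 1 ^ s : Poly k) = f k E := by
    simp [← hf]
  -- Independence lifts `q₁ ^ n (f u) = f d` to a polynomial identity, where the prime representing
  -- `f` does not divide `X 0` and so divides `U`.
  have h3 : MvPolynomial.X 0 ^ n * U =
      (MvPolynomial.X 0 * MvPolynomial.X 2 - MvPolynomial.X 1 ^ s) * V := by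
    refine hind ?_
    rw [map_mul, map_mul, hF, hU, hV, ← hP]
    simp
  obtain ⟨W, hW⟩ : (MvPolynomial.X 0 * MvPolynomial.X 2 - MvPolynomial.X 1 ^ s : Poly k) ∣ U := by
    have hpr := prime_X_zero_mul_X_two_sub (k := k) s
    refine (hpr.dvd_or_dvd ⟨V, h3⟩).resolve_left fun h => ?_
    obtain ⟨c, hc⟩ := hpr.dvd_of_dvd_pow h
    have := congrArg (MvPolynomial.eval (![1, 1, 1] : Fin 3 → k)) hc
    simp at this
  refine (hrange u).mpr ⟨W, ?_⟩
  rw [hW, map_mul, hF] at hU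
  exact mul_left_cancel₀ (f_ne_zero k E) hU

end Descent

/-! ### The generator `q₃`. -/

section ThirdGenerator

variable {k : Type*} [Field k] {E : Exponents} {p s : ℕ} {h : Poly k}

/-- Replacing `q ^ s` by `(f ^ (l p) q₂) ^ s = f ^ (l t) q₂ ^ s` in `g q₁ = f ^ (l t + 1) + q ^ s`
costs a multiple of `q₁`. Hence `q₁ N = f ^ (l t) (f + q₂ ^ s)` for some `N`, and `f ^ (l t)`
divides `N` because the prime `f` does not divide `q₁`. -/
theorem exists_thirdGen (hp : p.Prime) (hts : E.t = p * s) {q₂ c : Poly k}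
    (hq₂ : f k E ^ (E.l * p) * q₂ = q k E p h - firstGen E p s h * c) :
    ∃ q₃ : Poly k, firstGen E p s h * q₃ - q₂ ^ s = f k E ∧
      f k E ^ (E.l * E.t) * q₃ = g k E - c *
        ∑ i ∈ Finset.range s, (f k E ^ (E.l * p) * q₂) ^ i * q k E p h ^ (s - 1 - i) := by
  set N := g k E - c *
    ∑ i ∈ Finset.range s, (f k E ^ (E.l * p) * q₂) ^ i * q k E p h ^ (s - 1 - i) with hN
  have h1 : firstGen E p s h * N = f k E ^ (E.l * E.t) * (f k E + q₂ ^ s) := by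
    have h2 := g_mul_firstGen (h := h) hp hts
    have h3 := geom_sum₂_mul (f k E ^ (E.l * p) * q₂) (q k E p h) s
    rw [show f k E ^ (E.l * p) * q₂ - q k E p h = -(firstGen E p s h * c) by rw [hq₂]; ring,
      mul_pow, ← pow_mul, mul_assoc, ← hts] at h3
    rw [hN]
    linear_combination h2 + h3
  have hnd : ¬ f k E ∣ firstGen E p s h := not_f_dvd (by rw [param_firstGen]; simp)
  obtain ⟨q₃, hq₃⟩ := (prime_f k E).pow_dvd_of_dvd_mul_left _ hnd ⟨_, h1⟩
  refine ⟨q₃, ?_, hq₃.symm⟩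
  have := pow_ne_zero (E.l * E.t) (f_ne_zero k E)
  refine mul_left_cancel₀ this ?_
  rw [hq₃] at h1
  linear_combination h1

end ThirdGenerator

end RankThree

namespace RankThree

open Polynomial

/-! ### The invariants of `ε_h`. -/

section Exponential

variable {k : Type*} [Field k] {E : Exponents} {p s : ℕ} {h : Poly k}

/-- With `b = f ^ l g h`, the polynomial `X ^ p - b ^ (p - 1) X` is additive and vanishes at `b`, so
it is unchanged by `r ↦ r + b`. -/
theorem q_mem_expInvariants [CharP k p] (hp : p.Prime) (hh : h ∈ actionInvariants k E) :
    q k E p h ∈ expInvariants k E h := by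
  have := Fact.mk hp
  rw [mem_expInvariants, q, map_sub, map_mul, map_pow, map_pow, map_mul, map_mul, map_pow,
    expAut_r, expAut_of_mem h hh, expAut_of_mem h (f_mem_actionInvariants k E),
    expAut_of_mem h (g_mem_actionInvariants k E), add_pow_char]
  set b := f k E ^ E.l * g k E * h
  have : b ^ p = b ^ (p - 1) * b := (pow_sub_one_mul hp.ne_zero b).symm
  rw [this]
  ring

theorem actionInvariants_le_expInvariants : actionInvariants k E ≤ expInvariants k E h :=
  fun _ hu => expAut_of_mem h hu

theorem mem_expInvariants_of_mul_mem {a u : Poly k} (ha : a ∈ expInvariants k E h) (ha0 : a ≠ 0)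
    (hu : a * u ∈ expInvariants k E h) : u ∈ expInvariants k E h := by
  rw [mem_expInvariants] at *
  rw [map_mul, ha] at hu
  exact mul_left_cancel₀ ha0 hu

/-- A polynomial of degree less than `p` in `r` with invariant coefficients is invariant under
`ε_h` only if it is constant. -/
theorem eval_r_eq_coeff_zero [CharP k p] (h0 : h ≠ 0) (hh : h ∈ actionInvariants k E)
    {V : (Poly k)[X]} (hV : ∀ n, V.coeff n ∈ expInvariants k E h) (hdeg : V.natDegree < p)
    (hinv : V.eval (r k E) ∈ expInvariants k E h) : V.eval (r k E) = V.coeff 0 := by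
  set b := f k E ^ E.l * g k E * h with hb
  have hb0 : b ≠ 0 := mul_ne_zero (mul_ne_zero (pow_ne_zero _ (f_ne_zero k E)) (g_ne_zero k E)) h0
  have hbinv : expAut k E h b = b :=
    expAut_of_mem h (mul_mem (mul_mem (pow_mem (f_mem_actionInvariants k E) _)
      (g_mem_actionInvariants k E)) hh)
  have hstep : ∀ x, expAut k E h (V.eval x) = V.eval (expAut k E h x) := fun x => by
    rw [eval_eq_sum_range, eval_eq_sum_range, map_sum]
    refine Finset.sum_congr rfl fun i _ => ?_
    rw [map_mul, map_pow, (mem_expInvariants k E).mp (hV i)]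
  have hj : ∀ j : ℕ, V.eval (r k E + j * b) = V.eval (r k E) := by
    intro j
    induction j with
    | zero => simp
    | succ j ih =>
      have := congrArg (expAut k E h) ih
      rw [hstep, (mem_expInvariants k E).mp hinv, map_add, map_mul, hbinv, expAut_r,
        map_natCast, ← hb] at this
      rw [← this]
      congr 1
      push_cast
      ring
  -- Degree less than `p`, but the `p` distinct zeros `r + j b` with `j < p`.
  have hzero : V - C (V.eval (r k E)) = 0 := by
    refine eq_zero_of_natDegree_lt_card_of_eval_eq_zero _ (ι := Fin p)
      (f := fun j => r k E + ((j : ℕ) : Poly k) * b) (fun i j hij => ?_) (fun j => ?_) ?_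
    · have := mul_right_cancel₀ hb0 (add_left_cancel hij)
      exact Fin.ext (CharP.natCast_injOn_Iio (Poly k) p i.2 j.2 this)
    · rw [eval_sub, eval_C, hj, sub_self]
    · rwa [natDegree_sub_C, Fintype.card_fin]
  have := congrArg (fun P => coeff P 0) hzero
  simp only [coeff_sub, coeff_C_zero, coeff_zero] at this
  exact (sub_eq_zero.mp this).symm

/-- The polynomial over `D` with root `r` given by the definition of `q`. -/
theorem exists_monic_root (hp : p.Prime) {D : Subalgebra k (Poly k)}
    (hf : f k E ∈ D) (hg : g k E ∈ D) (hh : h ∈ D) (hq : q k E p h ∈ D) :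
    ∃ Q : D[X], Q.Monic ∧ Q.natDegree = p ∧ aeval (r k E) Q = 0 := by
  let b : D := ⟨(f k E ^ E.l * g k E * h) ^ (p - 1),
    D.pow_mem (D.mul_mem (D.mul_mem (D.pow_mem hf _) hg) hh) _⟩
  let e : D := ⟨q k E p h, hq⟩
  have hdeg : (C b * X + C e).degree < (p : WithBot ℕ) :=
    degree_linear_le.trans_lt (by exact_mod_cast hp.one_lt)
  refine ⟨X ^ p - (C b * X + C e), monic_X_pow_sub hdeg, ?_, ?_⟩
  · refine natDegree_eq_of_degree_eq_some ?_
    rw [degree_sub_eq_left_of_degree_lt (by rwa [degree_X_pow]), degree_X_pow]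
  · rw [aeval_def, eval₂_sub, eval₂_add, eval₂_mul, eval₂_pow, eval₂_X, eval₂_C, eval₂_C]
    change r k E ^ p - ((f k E ^ E.l * g k E * h) ^ (p - 1) * r k E + q k E p h) = 0
    rw [q]
    ring

/-- Here `x₁ = q₁ - f ^ l w` is itself a polynomial in `r` over `D`, so inverting `f` alone
suffices. -/
theorem exists_f_pow_mul_eq_aeval {D : Subalgebra k (Poly k)}
    (hf : f k E ∈ D) (hg : g k E ∈ D) (hh : h ∈ D) (h1 : firstGen E p s h ∈ D) (u : Poly k) :
    ∃ (n : ℕ) (U : D[X]), f k E ^ n * u = aeval (r k E) U := by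
  let S : Subalgebra k (Poly k) := (aeval (R := D) (r k E)).range.restrictScalars k
  have hDS : ∀ c ∈ D, c ∈ S := fun c hc => ⟨C ⟨c, hc⟩, by simp⟩
  have hr : r k E ∈ S := ⟨X, by simp⟩
  have key : u ∈ saturation S _ (hDS _ hf) := by
    refine mem_of_X_zero_mem (hDS _ hf) (hDS _ hg) hr (fun v hv => mem_saturation_of_mul hv) ?_ u
    refine le_saturation ?_
    have : MvPolynomial.X 0 = firstGen E p s h - f k E ^ E.l * tailPoly E p s h := by
      rw [firstGen]; ring
    rw [this]
    exact S.sub_mem (hDS _ h1) (S.mul_mem (S.pow_mem (hDS _ hf) _)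
      (tailPoly_mem (hDS _ hf) (hDS _ hg) hr (hDS _ hh)))
  obtain ⟨n, U, hU⟩ := key
  exact ⟨n, U, hU.symm⟩

/-- The polynomial ring is algebraic over `k[x]`, since `r` is and the rest is generated by `r` up
to powers of `f`. Three elements with this property in transcendence degree three are independent.
-/
theorem algebraicIndependent_of_mem (hp : p.Prime) {x : Fin 3 → Poly k}
    (hf : f k E ∈ Algebra.adjoin k (Set.range x)) (hg : g k E ∈ Algebra.adjoin k (Set.range x))
    (hh : h ∈ Algebra.adjoin k (Set.range x)) (hq : q k E p h ∈ Algebra.adjoin k (Set.range x))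
    (h1 : firstGen E p s h ∈ Algebra.adjoin k (Set.range x)) : AlgebraicIndependent k x := by
  set D := Algebra.adjoin k (Set.range x)
  obtain ⟨Q, hQ, -, hroot⟩ := exists_monic_root hp hf hg hh hq
  have hr : IsAlgebraic D (r k E) := IsIntegral.isAlgebraic ⟨Q, hQ, hroot⟩
  have : Algebra.IsAlgebraic D (Poly k) := by
    refine ⟨fun u => ?_⟩
    obtain ⟨n, U, hU⟩ := exists_f_pow_mul_eq_aeval hf hg hh h1 u
    refine IsAlgebraic.of_mul (mem_nonZeroDivisors_of_ne_zero (pow_ne_zero n (f_ne_zero k E)))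
      (isAlgebraic_algebraMap (⟨_, D.pow_mem hf n⟩ : D)) ?_
    rw [hU]
    exact Algebra.adjoin_le (S := Subalgebra.algebraicClosure D (Poly k))
      (Set.singleton_subset_iff.mpr hr) (aeval_mem_adjoin_singleton D (r k E))
  refine (Algebra.IsAlgebraic.isTranscendenceBasis_of_lift_le_trdeg_of_finite k x ?_).1
  rw [MvPolynomial.trdeg_of_isDomain]
  simp

/-- The ring of invariants of `ε_h` is generated by `q₁, q₂, q₃` as soon as
`f ^ (l p) q₂ ≡ q` modulo `q₁ k[f, q₁]`. -/
theorem expInvariants_eq_adjoin [CharP k p] (hp : p.Prime) (hts : E.t = p * s) (h0 : h ≠ 0)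
    (hh : h ∈ Algebra.adjoin k {f k E, g k E}) {q₂ q₃ c : Poly k}
    (hc : c ∈ Algebra.adjoin k {f k E, firstGen E p s h})
    (hq₂ : f k E ^ (E.l * p) * q₂ = q k E p h - firstGen E p s h * c)
    (hdeg : 0 < (param k E q₂).natDegree)
    (hq₃ : firstGen E p s h * q₃ - q₂ ^ s = f k E)
    (hq₃' : f k E ^ (E.l * E.t) * q₃ = g k E - c *
        ∑ i ∈ Finset.range s, (f k E ^ (E.l * p) * q₂) ^ i * q k E p h ^ (s - 1 - i)) :
    expInvariants k E h = Algebra.adjoin k {firstGen E p s h, q₂, q₃} ∧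
      AlgebraicIndependent k ![firstGen E p s h, q₂, q₃] := by
  set D := Algebra.adjoin k {firstGen E p s h, q₂, q₃} with hD
  set B := expInvariants k E h
  have m1 : firstGen E p s h ∈ D := Algebra.subset_adjoin (by simp)
  have m2 : q₂ ∈ D := Algebra.subset_adjoin (by simp)
  have m3 : q₃ ∈ D := Algebra.subset_adjoin (by simp)
  have hfD : f k E ∈ D := hq₃ ▸ D.sub_mem (D.mul_mem m1 m3) (D.pow_mem m2 s)
  have hcD : c ∈ D := by
    refine (Algebra.adjoin_le ?_ : _ ≤ D) hc
    rintro _ (rfl | rfl)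
    · exact hfD
    · exact m1
  have hqD : q k E p h ∈ D := by
    rw [sub_eq_iff_eq_add.mp hq₂.symm]
    exact D.add_mem (D.mul_mem (D.pow_mem hfD _) m2) (D.mul_mem m1 hcD)
  have hgD : g k E ∈ D := by
    rw [sub_eq_iff_eq_add.mp hq₃'.symm]
    exact D.add_mem (D.mul_mem (D.pow_mem hfD _) m3) (D.mul_mem hcD
      (geom_sum_mem D (D.mul_mem (D.pow_mem hfD _) m2) hqD s))
  have hhD : h ∈ D := by
    refine (Algebra.adjoin_le ?_ : _ ≤ D) hh
    rintro _ (rfl | rfl)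
    · exact hfD
    · exact hgD
  have hrange := range_vec_three (firstGen E p s h) q₂ q₃
  have hind : AlgebraicIndependent k ![firstGen E p s h, q₂, q₃] := by
    refine algebraicIndependent_of_mem (E := E) (h := h) (s := s) hp ?_ ?_ ?_ ?_ ?_ <;>
      rw [hrange] <;> assumption
  have hhI := adjoin_f_g_le_actionInvariants hh
  have hfB : f k E ∈ B := actionInvariants_le_expInvariants (f_mem_actionInvariants k E)
  have hgB : g k E ∈ B := actionInvariants_le_expInvariants (g_mem_actionInvariants k E)
  have hqB : q k E p h ∈ B := q_mem_expInvariants hp hhI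
  have h1B : firstGen E p s h ∈ B := by
    refine mem_expInvariants_of_mul_mem hgB (g_ne_zero k E) ?_
    rw [g_mul_firstGen hp hts]
    exact B.add_mem (B.pow_mem hfB _) (B.pow_mem hqB _)
  have hcB : c ∈ B := by
    refine (Algebra.adjoin_le ?_ : _ ≤ B) hc
    rintro _ (rfl | rfl)
    · exact hfB
    · exact h1B
  have h2B : q₂ ∈ B := by
    refine mem_expInvariants_of_mul_mem (B.pow_mem hfB (E.l * p))
      (pow_ne_zero _ (f_ne_zero k E)) ?_
    rw [hq₂]
    exact B.sub_mem hqB (B.mul_mem h1B hcB)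
  have h3B : q₃ ∈ B := by
    refine mem_expInvariants_of_mul_mem (B.pow_mem hfB (E.l * E.t))
      (pow_ne_zero _ (f_ne_zero k E)) ?_
    rw [hq₃']
    exact B.sub_mem hgB (B.mul_mem hcB
      (geom_sum_mem B (B.mul_mem (B.pow_mem hfB _) h2B) hqB s))
  have hDB : D ≤ B := by
    refine Algebra.adjoin_le ?_
    rintro _ (rfl | rfl | rfl)
    · exact h1B
    · exact h2B
    · exact h3B
  refine ⟨le_antisymm (fun u hu => ?_) hDB, hind⟩
  obtain ⟨n, U, hU⟩ := exists_f_pow_mul_eq_aeval hfD hgD hhD m1 u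
  -- Division by the monic equation of `r` brings the degree in `r` below `p`.
  obtain ⟨Q, hQ, hQp, hroot⟩ := exists_monic_root hp hfD hgD hhD hqD
  have hUQ := aeval_modByMonic_eq_self_of_root (p := U) hroot
  have hlt : (U %ₘ Q).natDegree < p := by
    refine (natDegree_modByMonic_lt U hQ fun h => ?_).trans_eq hQp
    rw [h, natDegree_one] at hQp
    exact hp.ne_zero hQp.symm
  have hmem : f k E ^ n * u ∈ D := by
    have hev : f k E ^ n * u = ((U %ₘ Q).map (algebraMap D (Poly k))).eval (r k E) := by
      rw [eval_map_algebraMap, hUQ, hU]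
    have huB := B.mul_mem (B.pow_mem hfB n) hu
    rw [hev] at huB ⊢
    rw [eval_r_eq_coeff_zero h0 hhI (fun i => ?_) (natDegree_map_le.trans_lt hlt) huB]
    · rw [coeff_map]
      exact ((U %ₘ Q).coeff 0).2
    · rw [coeff_map]
      exact hDB ((U %ₘ Q).coeff i).2
  clear hU
  induction n with
  | zero => simpa using hmem
  | succ n ih =>
    refine ih (mem_adjoin_of_f_mul_mem hind hq₃ param_firstGen hdeg ?_)
    rwa [← mul_assoc, ← pow_succ']

/-- Generators of the ring of invariants of `ε_h`, from a correction term. -/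
theorem exists_generators [CharP k p] (hp : p.Prime) (hts : E.t = p * s) (h0 : h ≠ 0)
    (hh : h ∈ Algebra.adjoin k {f k E, g k E}) {c a v : Poly k}
    (hcm : c ∈ Algebra.adjoin k {f k E, firstGen E p s h})
    (ha : a ∈ baseRing k E) (hv : v ∈ baseRing k E)
    (hc : (g k E * h) ^ (p - 1) * r k E - firstGen E p s h * c =
        f k E ^ E.l * (a * MvPolynomial.X 1 + v)) :
    ∃ q₂ q₃ : Poly k,
      f k E ^ (E.l * p) * q₂ = q k E p h - firstGen E p s h ^ (E.m * p) +
        f k E ^ (E.l * (p - 1)) * (firstGen E p s h * c) ∧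
      firstGen E p s h * q₃ - q₂ ^ s = f k E ∧
      expInvariants k E h = Algebra.adjoin k {firstGen E p s h, q₂, q₃} ∧
      AlgebraicIndependent k ![firstGen E p s h, q₂, q₃] := by
  obtain ⟨q₂, hq₂, hdeg⟩ := exists_secondGen hp hh ha hv hc
  obtain ⟨n, hn⟩ : ∃ n, E.m * p = n + 1 :=
    ⟨E.m * p - 1, by have := Nat.mul_pos E.one_le_m hp.pos; omega⟩
  -- Both correction terms are multiples of `q₁`, which puts the equation in the form that
  -- `exists_thirdGen` takes.
  have hq₂' : f k E ^ (E.l * p) * q₂ = q k E p h - firstGen E p s h *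
      (firstGen E p s h ^ n - f k E ^ (E.l * (p - 1)) * c) := by
    rw [hq₂, hn]
    ring
  have hc' : firstGen E p s h ^ n - f k E ^ (E.l * (p - 1)) * c ∈
      Algebra.adjoin k {f k E, firstGen E p s h} :=
    sub_mem (pow_mem (Algebra.subset_adjoin (by simp)) _)
      (mul_mem (pow_mem (Algebra.subset_adjoin (by simp)) _) hcm)
  obtain ⟨q₃, hq₃, hq₃'⟩ := exists_thirdGen hp hts hq₂'
  exact ⟨q₂, q₃, hq₂, hq₃, expInvariants_eq_adjoin hp hts h0 hh hc' hq₂' hdeg hq₃ hq₃'⟩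

end Exponential

end RankThree

namespace RankThree

open Polynomial

/-! ### The map `ψ` on `k[x₁, x₂ ^ p, x₃]`. -/

section Psi

variable {k : Type*} [Field k] {E : Exponents} {p s : ℕ} {h : Poly k}

theorem incl_injective : Function.Injective (incl k) :=
  IsFractionRing.injective (Poly k) (RatFun k)

/-- The case `h = 0` of `exists_thirdGen`: then `q = r ^ p`, `q₁ = x₁`, and `q₂ = x₂ ^ p` forces `q₃
= x₃`. It shows that `x₃` involves `r` only through `r ^ p`. -/
theorem f_pow_mul_X_two [CharP k p] (hp : p.Prime) (hts : E.t = p * s) :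
    f k E ^ (E.l * E.t) * MvPolynomial.X 2 = g k E - MvPolynomial.X 0 ^ (E.m * p - 1) *
      ∑ i ∈ Finset.range s,
        (r k E ^ p - MvPolynomial.X 0 ^ (E.m * p)) ^ i * (r k E ^ p) ^ (s - 1 - i) := by
  have hp1 : p - 1 ≠ 0 := by have := hp.two_le; omega
  have h1 : firstGen E p s (0 : Poly k) = MvPolynomial.X 0 := by simp [firstGen, tailPoly, hp1]
  have hq : q k E p 0 = r k E ^ p := by simp [q, hp1]
  have h2 : f k E ^ (E.l * p) * MvPolynomial.X 1 ^ p =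
      r k E ^ p - MvPolynomial.X 0 ^ (E.m * p) := by
    rw [r_pow hp]; ring
  obtain ⟨q₃, h3, h4⟩ := exists_thirdGen (h := (0 : Poly k)) (q₂ := MvPolynomial.X 1 ^ p)
    (c := MvPolynomial.X 0 ^ (E.m * p - 1)) hp hts (by
      have := Nat.mul_pos E.one_le_m hp.pos
      rw [h2, hq, h1, ← pow_succ', Nat.sub_add_cancel this])
  rw [h1, ← pow_mul, ← hts, f_eq] at h3
  have : q₃ = MvPolynomial.X 2 := by
    refine mul_left_cancel₀ (MvPolynomial.X_ne_zero (0 : Fin 3)) ?_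
    linear_combination h3
  rwa [this, h2, hq] at h4

theorem mem_ringCrp_of_mem {c : RatFun k} (hc : c ∈ ringC k E) : c ∈ ringCrp k E p :=
  (ringCrp k E p).algebraMap_mem ⟨c, hc⟩

theorem r_pow_mem : incl k (r k E) ^ p ∈ ringCrp k E p := ⟨X, by simp⟩

theorem mem_ringCrp_of_pow_mul {u : RatFun k} (n : ℕ)
    (hu : incl k (f k E) ^ n * u ∈ ringCrp k E p) : u ∈ ringCrp k E p := by
  have hf : incl k (f k E) ≠ 0 := by simpa using f_ne_zero k E
  have : u = (incl k (f k E))⁻¹ ^ n * (incl k (f k E) ^ n * u) := by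
    rw [← mul_assoc, ← mul_pow, inv_mul_cancel₀ hf, one_pow, one_mul]
  rw [this]
  exact mul_mem (pow_mem (mem_ringCrp_of_mem (f_inv_mem k E)) n) hu

theorem X_zero_mem_ringCrp (hts : E.t = p * s) :
    incl k (MvPolynomial.X 0) ∈ ringCrp k E p := by
  rw [X_zero_eq k E, hts, pow_mul (incl k (r k E))]
  exact mul_mem (mem_ringCrp_of_mem (g_inv_mem k E))
    (add_mem (pow_mem (mem_ringCrp_of_mem (f_mem k E)) _) (pow_mem r_pow_mem _))

theorem X_one_pow_mem_ringCrp [CharP k p] (hp : p.Prime) (hts : E.t = p * s) :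
    incl k (MvPolynomial.X 1 ^ p) ∈ ringCrp k E p := by
  refine mem_ringCrp_of_pow_mul (E.l * p) ?_
  have h2 : f k E ^ (E.l * p) * MvPolynomial.X 1 ^ p =
      r k E ^ p - MvPolynomial.X 0 ^ (E.m * p) := by
    rw [r_pow hp]; ring
  rw [← map_pow, ← map_mul, h2, map_sub, map_pow, map_pow]
  exact sub_mem r_pow_mem (pow_mem (X_zero_mem_ringCrp hts) _)

theorem X_two_mem_ringCrp [CharP k p] (hp : p.Prime) (hts : E.t = p * s) :
    incl k (MvPolynomial.X 2) ∈ ringCrp k E p := by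
  refine mem_ringCrp_of_pow_mul (E.l * E.t) ?_
  have h0 := X_zero_mem_ringCrp (k := k) hts
  rw [← map_pow, ← map_mul, f_pow_mul_X_two hp hts]
  simp only [map_sub, map_mul, map_sum, map_pow]
  exact sub_mem (mem_ringCrp_of_mem (g_mem k E)) (mul_mem (pow_mem h0 _)
    (sum_mem fun i _ => mul_mem (pow_mem (sub_mem r_pow_mem (pow_mem h0 _)) _)
      (pow_mem r_pow_mem _)))

variable (k E p) in
/-- The map `ψ` as a homomorphism of rings. -/
noncomputable def psiHom (hp : 0 < p) (h : Poly k) : ringCrp k E p →+* RatFun k :=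
  (psi k E p hp h).toRingHom

theorem psi_of_mem (hp : 0 < p) {c : RatFun k} (hc : c ∈ ringC k E) :
    psiHom k E p hp h ⟨c, mem_ringCrp_of_mem hc⟩ = c :=
  (psi k E p hp h).commutes ⟨c, hc⟩

theorem psi_r_pow (hp : 0 < p) :
    psiHom k E p hp h ⟨incl k (r k E) ^ p, r_pow_mem⟩ = incl k (q k E p h) := by
  have h1 : (polyEquivCrp k E p hp).symm ⟨incl k (r k E) ^ p, r_pow_mem⟩ = X := by
    rw [AlgEquiv.symm_apply_eq]
    apply Subtype.ext
    change _ = aeval (R := ringC k E) (incl k (r k E) ^ p) X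
    rw [aeval_X]
  change aeval (R := ringC k E) (incl k (q k E p h)) ((polyEquivCrp k E p hp).symm _) = _
  rw [h1, aeval_X]

/-- Apply `ψ` to `g x₁ = f ^ (l t + 1) + (r ^ p) ^ s` and cancel `g`. The next two lemmas likewise
transport the relations defining `r ^ p` and `f`. -/
theorem psi_X_zero (hp : p.Prime) (hts : E.t = p * s) :
    psiHom k E p hp.pos h ⟨incl k (MvPolynomial.X 0), X_zero_mem_ringCrp hts⟩ =
      incl k (firstGen E p s h) := by
  have hg : incl k (g k E) ≠ 0 := by simpa using g_ne_zero k E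
  have h1 : (⟨incl k (g k E), mem_ringCrp_of_mem (g_mem k E)⟩ : ringCrp k E p) *
      ⟨incl k (MvPolynomial.X 0), X_zero_mem_ringCrp hts⟩ =
      ⟨incl k (f k E), mem_ringCrp_of_mem (f_mem k E)⟩ ^ (E.l * E.t + 1) +
        ⟨incl k (r k E) ^ p, r_pow_mem⟩ ^ s := by
    apply Subtype.ext
    change incl k (g k E) * incl k (MvPolynomial.X 0) =
      incl k (f k E) ^ (E.l * E.t + 1) + (incl k (r k E) ^ p) ^ s
    rw [← pow_mul, ← hts, ← map_mul, mul_comm, X_zero_mul_g, map_add, map_pow, map_pow]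
  have h2 := congrArg (psiHom k E p hp.pos h) h1
  rw [RingHom.map_mul, RingHom.map_add, RingHom.map_pow, RingHom.map_pow,
    psi_of_mem _ (g_mem k E), psi_of_mem _ (f_mem k E), psi_r_pow,
    ← map_pow, ← map_pow, ← map_add, ← g_mul_firstGen hp hts, map_mul] at h2
  exact mul_left_cancel₀ hg h2

theorem f_pow_mul_psi_X_one_pow [CharP k p] (hp : p.Prime) (hts : E.t = p * s) :
    incl k (f k E) ^ (E.l * p) *
      psiHom k E p hp.pos h ⟨incl k (MvPolynomial.X 1 ^ p), X_one_pow_mem_ringCrp hp hts⟩ =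
      incl k (q k E p h - firstGen E p s h ^ (E.m * p)) := by
  have h1 : (⟨incl k (f k E), mem_ringCrp_of_mem (f_mem k E)⟩ : ringCrp k E p) ^ (E.l * p) *
      ⟨incl k (MvPolynomial.X 1 ^ p), X_one_pow_mem_ringCrp hp hts⟩ +
        ⟨incl k (MvPolynomial.X 0), X_zero_mem_ringCrp hts⟩ ^ (E.m * p) =
      ⟨incl k (r k E) ^ p, r_pow_mem⟩ := by
    apply Subtype.ext
    change incl k (f k E) ^ (E.l * p) * incl k (MvPolynomial.X 1 ^ p) +
      incl k (MvPolynomial.X 0) ^ (E.m * p) = incl k (r k E) ^ p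
    rw [← map_pow, ← map_pow, ← map_pow, ← map_mul, ← map_add, r_pow hp]
  have h2 := congrArg (psiHom k E p hp.pos h) h1
  rw [RingHom.map_add, RingHom.map_mul, RingHom.map_pow, RingHom.map_pow,
    psi_of_mem _ (f_mem k E), psi_r_pow, psi_X_zero hp hts] at h2
  rw [map_sub, map_pow (incl k) (firstGen E p s h), ← h2, add_sub_cancel_right]

theorem firstGen_mul_psi_X_two [CharP k p] (hp : p.Prime) (hts : E.t = p * s) :
    incl k (firstGen E p s h) *
      psiHom k E p hp.pos h ⟨incl k (MvPolynomial.X 2), X_two_mem_ringCrp hp hts⟩ =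
      incl k (f k E) +
        psiHom k E p hp.pos h ⟨incl k (MvPolynomial.X 1 ^ p), X_one_pow_mem_ringCrp hp hts⟩ ^ s := by
  have h1 : (⟨incl k (MvPolynomial.X 0), X_zero_mem_ringCrp hts⟩ : ringCrp k E p) *
      ⟨incl k (MvPolynomial.X 2), X_two_mem_ringCrp hp hts⟩ =
      ⟨incl k (f k E), mem_ringCrp_of_mem (f_mem k E)⟩ +
        ⟨incl k (MvPolynomial.X 1 ^ p), X_one_pow_mem_ringCrp hp hts⟩ ^ s := by
    apply Subtype.ext
    change incl k (MvPolynomial.X 0) * incl k (MvPolynomial.X 2) =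
      incl k (f k E) + incl k (MvPolynomial.X 1 ^ p) ^ s
    rw [← map_pow, ← pow_mul, ← hts, ← map_mul, ← map_add, f_eq]
    congr 1
    ring
  have h2 := congrArg (psiHom k E p hp.pos h) h1
  rwa [RingHom.map_mul, RingHom.map_add, RingHom.map_pow, psi_of_mem _ (f_mem k E), psi_X_zero hp hts] at h2

theorem adjoin_le_ringCrp [CharP k p] (hp : p.Prime) (hts : E.t = p * s) :
    Algebra.adjoin k {incl k (MvPolynomial.X 0), incl k (MvPolynomial.X 1 ^ p),
      incl k (MvPolynomial.X 2)} ≤ (ringCrp k E p).restrictScalars k := by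
  refine Algebra.adjoin_le ?_
  rintro _ (rfl | rfl | rfl)
  · exact X_zero_mem_ringCrp hts
  · exact X_one_pow_mem_ringCrp hp hts
  · exact X_two_mem_ringCrp hp hts

theorem psi_image_eq [CharP k p] (hp : p.Prime) (hts : E.t = p * s) :
    psi k E p hp.pos h '' {u | (u : RatFun k) ∈ Algebra.adjoin k {incl k (MvPolynomial.X 0),
      incl k (MvPolynomial.X 1 ^ p), incl k (MvPolynomial.X 2)}} =
    Algebra.adjoin k {incl k (firstGen E p s h),
      psiHom k E p hp.pos h ⟨incl k (MvPolynomial.X 1 ^ p), X_one_pow_mem_ringCrp hp hts⟩,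
      psiHom k E p hp.pos h ⟨incl k (MvPolynomial.X 2), X_two_mem_ringCrp hp hts⟩} := by
  let a : ringCrp k E p := ⟨incl k (MvPolynomial.X 0), X_zero_mem_ringCrp hts⟩
  let b : ringCrp k E p := ⟨incl k (MvPolynomial.X 1 ^ p), X_one_pow_mem_ringCrp hp hts⟩
  let c : ringCrp k E p := ⟨incl k (MvPolynomial.X 2), X_two_mem_ringCrp hp hts⟩
  let val : ringCrp k E p →ₐ[k] RatFun k := (ringCrp k E p).val.restrictScalars k
  have h1 : Algebra.adjoin k {incl k (MvPolynomial.X 0), incl k (MvPolynomial.X 1 ^ p),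
      incl k (MvPolynomial.X 2)} = (Algebra.adjoin k {a, b, c}).map val := by
    rw [AlgHom.map_adjoin, Set.image_insert_eq, Set.image_pair]
    rfl
  have h2 : {u : ringCrp k E p | (u : RatFun k) ∈ Algebra.adjoin k {incl k (MvPolynomial.X 0),
      incl k (MvPolynomial.X 1 ^ p), incl k (MvPolynomial.X 2)}} =
      (Algebra.adjoin k {a, b, c} : Set (ringCrp k E p)) := by
    ext u
    rw [Set.mem_ofPred_eq, h1]
    constructor
    · rintro ⟨v, hv, hvu⟩
      rwa [← Subtype.val_injective hvu]
    · exact fun hu => ⟨u, hu, rfl⟩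
  have h3 := congrArg (fun S : Subalgebra k (RatFun k) => (S : Set (RatFun k)))
    (AlgHom.map_adjoin ((psi k E p hp.pos h).restrictScalars k) {a, b, c})
  rw [h2, ← psi_X_zero hp hts]
  rw [Set.image_insert_eq, Set.image_pair] at h3
  exact h3

end Psi

/-! ### When `ψ` maps onto the invariants. -/

section Main

variable {k : Type*} [Field k] {E : Exponents} {p s : ℕ} {h : Poly k}

theorem psi_image_eq_of_dvd [CharP k p] (hp : p.Prime) (hts : E.t = p * s) (h0 : h ≠ 0)
    (hh : h ∈ Algebra.adjoin k {f k E, g k E}) {u : Poly k}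
    (hu : u ∈ Algebra.adjoin k {f k E, g k E}) (hhu : h ^ (p - 1) = f k E ^ E.l * u) :
    psi k E p hp.pos h '' {u | (u : RatFun k) ∈ Algebra.adjoin k {incl k (MvPolynomial.X 0),
      incl k (MvPolynomial.X 1 ^ p), incl k (MvPolynomial.X 2)}} =
    incl k '' (expInvariants k E h : Set (Poly k)) := by
  have hM := adjoin_f_g_le_baseRing k E
  -- The term `(g h) ^ (p - 1) r` is already `f ^ l` times an element of `baseRing`, so no
  -- correction is needed and `f ^ (l p) q₂` is exactly `q - q₁ ^ (m p)`.
  obtain ⟨q₂, q₃, h2, h3, h4, -⟩ := exists_generators (c := 0) (a := 0)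
    (v := g k E ^ (p - 1) * u * r k E) hp hts h0 hh (zero_mem _) (zero_mem _)
    (mul_mem (mul_mem (pow_mem (g_mem_baseRing k E) _) (hM hu)) (r_mem_baseRing k E))
    (by rw [mul_pow, hhu]; ring)
  rw [mul_zero, mul_zero, add_zero] at h2
  have hf : incl k (f k E) ≠ 0 := by simpa using f_ne_zero k E
  have hq1 : incl k (firstGen E p s h) ≠ 0 := fun h0 => by
    have := param_firstGen (k := k) (E := E) (p := p) (s := s) (h := h)
    rw [(map_eq_zero_iff _ incl_injective).mp h0, map_zero] at this
    exact C_ne_zero.mpr X_ne_zero this.symm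
  have e2 : psiHom k E p hp.pos h ⟨incl k (MvPolynomial.X 1 ^ p), X_one_pow_mem_ringCrp hp hts⟩ =
      incl k q₂ := by
    refine mul_left_cancel₀ (pow_ne_zero (E.l * p) hf) ?_
    rw [f_pow_mul_psi_X_one_pow hp hts, ← h2, map_mul, map_pow]
  have e3 : psiHom k E p hp.pos h ⟨incl k (MvPolynomial.X 2), X_two_mem_ringCrp hp hts⟩ =
      incl k q₃ := by
    refine mul_left_cancel₀ hq1 ?_
    rw [firstGen_mul_psi_X_two hp hts, e2, ← map_pow, ← map_add, ← map_mul, ← h3, sub_add_cancel]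
  rw [psi_image_eq hp hts, e2, e3, h4]
  have := congrArg (fun S : Subalgebra k (RatFun k) => (S : Set (RatFun k)))
    (AlgHom.map_adjoin (incl k) {firstGen E p s h, q₂, q₃})
  rw [Set.image_insert_eq, Set.image_pair] at this
  exact this.symm

/-- All of `q - q₁ ^ (m p)` except `f ^ (l (p - 1)) (g h) ^ (p - 1) r` is visibly divisible by `f ^
(l p)`. So `f ^ l` divides `g ^ (p - 1) r h ^ (p - 1)`, and `f` is prime to `g` and `r`, whose
restrictions are powers of `y`. -/
theorem f_pow_dvd_of_psi_mem [CharP k p] (hp : p.Prime) (hts : E.t = p * s)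
    (hh : h ∈ Algebra.adjoin k {f k E, g k E}) {b : Poly k}
    (hb : incl k b = psiHom k E p hp.pos h
      ⟨incl k (MvPolynomial.X 1 ^ p), X_one_pow_mem_ringCrp hp hts⟩) :
    f k E ^ E.l ∣ h ^ (p - 1) := by
  have := Fact.mk hp
  have h1 := f_pow_mul_psi_X_one_pow (h := h) hp hts
  rw [← hb, ← map_pow, ← map_mul] at h1
  have h2 := incl_injective h1
  obtain ⟨w, hw, h3⟩ := exists_firstGen_pow_eq (p := p) (s := s) hh E.m
  have h4 : firstGen E p s h ^ (E.m * p) =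
      MvPolynomial.X 0 ^ (E.m * p) + f k E ^ (E.l * p) * w ^ p := by
    rw [pow_mul, h3, add_pow_char, mul_pow, ← pow_mul, ← pow_mul]
  have h5 : f k E ^ (E.l * p) = f k E ^ (E.l * (p - 1)) * f k E ^ E.l := by
    rw [← pow_add, ← Nat.mul_succ, Nat.succ_eq_add_one, Nat.sub_add_cancel hp.one_le]
  have h6 : f k E ^ E.l * (MvPolynomial.X 1 ^ p - w ^ p - b) =
      g k E ^ (p - 1) * r k E * h ^ (p - 1) := by
    refine mul_left_cancel₀ (pow_ne_zero (E.l * (p - 1)) (f_ne_zero k E)) ?_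
    rw [h4, q, r_pow hp, mul_pow, mul_pow, ← pow_mul] at h2
    linear_combination -h2 - (MvPolynomial.X 1 ^ p - w ^ p - b) * h5
  have hnd : ¬ f k E ∣ g k E ^ (p - 1) * r k E := by
    refine not_f_dvd ?_
    rw [map_mul, map_pow, param_g, param_r]
    simp
  exact (prime_f k E).pow_dvd_of_dvd_mul_left _ hnd ⟨_, h6.symm⟩

end Main

end RankThree

theorem mainTheorem6 {k : Type*} [Field k] (p : ℕ) (hp : p.Prime) [CharP k p]
    (E : Exponents) (hpt : p ∣ E.t)
    (h : RankThree.Poly k) (hinv : h ∈ RankThree.actionInvariants k E) (h0 : h ≠ 0) :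
    ((∃ q₁ q₂ q₃ : RankThree.Poly k,
        q₁ ∈ RankThree.expInvariants k E h ∧
        q₂ ∈ RankThree.expInvariants k E h ∧
        q₃ ∈ RankThree.expInvariants k E h ∧
        RankThree.incl k q₁ = RankThree.q₁ k E p h ∧
        q₁ * q₃ - q₂ ^ (E.t / p) = RankThree.f k E ∧
        RankThree.expInvariants k E h = Algebra.adjoin k {q₁, q₂, q₃} ∧
        AlgebraicIndependent k ![q₁, q₂, q₃]) ∧
      Nonempty (RankThree.expInvariants k E h ≃ₐ[k] MvPolynomial (Fin 3) k)) ∧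
    ((Algebra.adjoin k {RankThree.incl k (MvPolynomial.X 0),
          RankThree.incl k (MvPolynomial.X 1 ^ p), RankThree.incl k (MvPolynomial.X 2)} :
          Set (RankThree.RatFun k)) ⊆ RankThree.ringCrp k E p ∧
      (RankThree.psi k E p hp.pos h ''
          {u | (u : RankThree.RatFun k) ∈ Algebra.adjoin k {RankThree.incl k (MvPolynomial.X 0),
            RankThree.incl k (MvPolynomial.X 1 ^ p), RankThree.incl k (MvPolynomial.X 2)}} =
          RankThree.incl k '' (RankThree.expInvariants k E h : Set (RankThree.Poly k)) ↔
        ∃ u ∈ Algebra.adjoin k {RankThree.f k E, RankThree.g k E},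
          h ^ (p - 1) = RankThree.f k E ^ E.l * u)) := by
  obtain ⟨s, hts⟩ := hpt
  have hs : E.t / p = s := by rw [hts, Nat.mul_div_cancel_left _ hp.pos]
  have ht : (E.t : k) = 0 := by rw [hts, Nat.cast_mul, CharP.cast_eq_zero, zero_mul]
  have hh : h ∈ Algebra.adjoin k {RankThree.f k E, RankThree.g k E} :=
    RankThree.actionInvariants_eq ht ▸ hinv
  refine ⟨?_, RankThree.adjoin_le_ringCrp hp hts, fun himage => ?_, ?_⟩
  · obtain ⟨c, hc, a, ha, v, hv, hcorr⟩ := RankThree.exists_correction hp hts hh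
    obtain ⟨q₂, q₃, -, h3, h4, h5⟩ := RankThree.exists_generators hp hts h0 hh hc ha hv hcorr
    refine ⟨⟨RankThree.firstGen E p s h, q₂, q₃, ?_, ?_, ?_, RankThree.incl_firstGen hp hts,
      by rwa [hs], h4, h5⟩, ?_⟩
    · exact h4 ▸ Algebra.subset_adjoin (by simp)
    · exact h4 ▸ Algebra.subset_adjoin (by simp)
    · exact h4 ▸ Algebra.subset_adjoin (by simp)
    · rw [h4, ← RankThree.range_vec_three]
      exact ⟨h5.aevalEquiv.symm⟩
  · obtain ⟨b, -, hb⟩ : RankThree.psi k E p hp.pos h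
        ⟨_, RankThree.X_one_pow_mem_ringCrp hp hts⟩ ∈
        RankThree.incl k '' (RankThree.expInvariants k E h : Set (RankThree.Poly k)) := by
      rw [← himage]
      exact ⟨_, Algebra.subset_adjoin (by simp), rfl⟩
    obtain ⟨u, hu⟩ := RankThree.f_pow_dvd_of_psi_mem hp hts hh hb
    refine ⟨u, ?_, hu⟩
    -- The cofactor `u` is `ε`-invariant because `h ^ (p - 1)` and `f ^ l` are and `f ^ l` can be
    -- cancelled; hence `u ∈ k[f, g]`.
    have hf := (RankThree.actionInvariants k E).pow_mem
      (RankThree.f_mem_actionInvariants k E) E.l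
    have hhp := (RankThree.actionInvariants k E).pow_mem hinv (p - 1)
    rw [hu] at hhp
    rw [← RankThree.actionInvariants_eq ht]
    rw [RankThree.mem_actionInvariants] at hf hhp ⊢
    rw [map_mul, hf, map_mul] at hhp
    refine mul_left_cancel₀ ?_ hhp
    exact Polynomial.C_ne_zero.mpr (pow_ne_zero _ (RankThree.f_ne_zero k E))
  · rintro ⟨u, hu, hhu⟩
    exact RankThree.psi_image_eq_of_dvd hp hts h0 hh hu hhu
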